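/- **Setting.** Let $N,n,p,q$ be the numbers of modes, states, inputs and measurements, let $\bar T>0$ and $h>0$, and consider the switched system with constant delay $$\dot x(t)=A_{\sigma(t)}x(t)+G_{\sigma(t)}x(t-h)+E_{\sigma(t)}w(t),\qquad y(t)=C_{\sigma(t)}x(t)+H_{\sigma(t)}x(t-h)+F_{\sigma(t)}w(t),$$ where $x$ is continuous and $x|_{[-h,0]}$ is a given continuous function. The signal $\sigma$ has minimum dwell-time $\bar T$: there are $0=t_0<t_1<\dots$ with $t_{k+1}-t_k\ge\bar T$ for all $k\ge0$, $\sigma$ is constant on each $(t_k,t_{k+1}]$ and takes different values on consecutive intervals. Solutions are Carathéodory solutions (on each $(t_k,t_{k+1}]$ the integral form of the equation holds, with integrable right-hand side). Let $M\in\mathbb R^{n\times n}_{\ge0}$. Inequalities between matrices and vectors are entrywise, $\mathbb 1$ is the vector of ones, and $X\succ0$ means positive definite. Given gain functions $\tilde L_i:[0,\bar T]\to\mathbb R^{n\times q}$, put $L_i(t)=\tilde L_i(\min(t-t_k,\bar T))$ for $t\in(t_k,t_{k+1}]$. For $\bullet\in\{-,+\}$ the observer is $$\dot x^\bullet(t)=A_\sigma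 x^\bullet(t)+G_\sigma x^\bullet(t-h)+E_\sigma w^\bullet(t)+L_\sigma(t)\bigl(y(t)-C_\sigma x^\bullet(t)-H_\sigma x^\bullet(t-h)-F_\sigma w^\bullet(t)\bigr).$$ The errors $e^+=x^+-x$, $e^-=x-x^-$ both obey, with $\delta^+=w^+-w$, $\delta^-=w-w^-$, $$\dot e(t)=(A_\sigma-L_\sigma(t)C_\sigma)e(t)+(G_\sigma-L_\sigma(t)H_\sigma)e(t-h)+(E_\sigma-L_\sigma(t)F_\sigma)\delta(t),\qquad e_c(t)=Me(t).\tag{1}$$ The associated impulsive system with multiple jump maps has one block $e_i\in\mathbb R^n$ per mode, $$\dot e_i(t)=(A_i-L_i(t)C_i)e_i(t)+(G_i-L_i(t)H_i)e_i(t-h)+(E_i-L_i(t)F_i)\delta_i(t),\quad e(t_k^+)=\bigl[(b_ib_j^{T})\otimes I_n\bigr]e(t_k),\quad e_c=[I_N\otimes M]e,\tag{2}$$ where $j$ and $i$ are the modes before and after $t_k$ ($k\ge1$), $b_1,\dots,b_N$ is the standard basis of $\mathbb R^N$, and the input is $(\delta_1,\dots,\delta_N)$. **Theorem.** Assume that there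 are differentiable functions $X_i:[0,\bar T]\to\mathbb R^{n\times n}$ with diagonal and invertible values, $X_i(0)\succ0$, $X_i(\bar T)\succ0$, arbitrary functions $Y_i:[0,\bar T]\to\mathbb R^{n\times q}$ ($i=1,\dots,N$), a diagonal $U\succ0$ and scalars $\varepsilon,\alpha,\gamma>0$ such that for all $\tau\in[0,\bar T]$ and all $i$ $$X_i(\tau)A_i-Y_i(\tau)C_i+\alpha I_n\ge0,\quad X_i(\tau)G_i-Y_i(\tau)H_i\ge0,\quad X_i(\tau)E_i-Y_i(\tau)F_i\ge0,$$ $$\mathbb 1^T[X_i(\bar T)A_i-Y_i(\bar T)C_i+U]+\mathbb 1^TM\le0,$$ $$\mathbb 1^T[X_i(\bar T)G_i-Y_i(\bar T)H_i-U]\le0,\quad \mathbb 1^T[X_i(\bar T)E_i-Y_i(\bar T)F_i]-\gamma\mathbb 1^T\le0,$$ $$\mathbb 1^T[\dot X_i(\tau)+X_i(\tau)A_i-Y_i(\tau)C_i+U]+\mathbb 1^TM\le0,$$ $$\mathbb 1^T[X_i(\tau)G_i-Y_i(\tau)H_i-U]\le0,\quad \mathbb 1^T[X_i(\tau)E_i-Y_i(\tau)F_i]-\gamma\mathbb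 1^T\le0,$$ and $\mathbb 1^T[X_i(0)-X_j(\bar T)+\varepsilon I_n]\le0$ for all $i\ne j$. Then the gains $\tilde L_i(\tau)=X_i(\tau)^{-1}Y_i(\tau)$ have the following properties. (a) *Positivity.* For all $i$ and $\tau\in[0,\bar T]$, $A_i-\tilde L_i(\tau)C_i$ is Metzler, and $E_i-\tilde L_i(\tau)F_i$ and $G_i-\tilde L_i(\tau)H_i$ are nonnegative. Moreover, if $w^-\le w\le w^+$ on $[0,\infty)$ and $x^-\le x\le x^+$ on $[-h,0]$, then $x^-(t)\le x(t)\le x^+(t)$ for all $t\ge0$. (b) *Stability.* With zero input, (1) and (2) are asymptotically stable under minimum dwell-time $\bar T$: for every $\epsilon'>0$ there is $\eta>0$ such that, for every signal of minimum dwell-time $\bar T$, every solution with $\sup_{[-h,0]}\|e\|<\eta$ satisfies $\|e(t)\|<\epsilon'$ for all $t\ge0$; and every solution tends to $0$ as $t\to\infty$. (c) *$L_1$-gain.* For (1) and for (2), the map from the input to $e_c$ has an $L_1$-gain of at most $\gamma$: there is an increasing $v:[0,\infty)\to\mathbb R$ with $v(0)=0$ and $v(s)\to\infty$ as $s\to\infty$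 such that, for every signal of minimum dwell-time $\bar T$, every input in $L_1(0,\infty)$ and every solution, $e_c\in L_1(0,\infty)$ and $\|e_c\|_{L_1}\le\gamma\,\|\text{input}\|_{L_1}+v\bigl(\sup_{[-h,0]}\|e\|\bigr)$, where $\|f\|_{L_1}=\int_0^\infty\sum_k|f_k(t)|\,dt$. -/

import Mathlib

open Set Filter Topology MeasureTheory
open scoped Matrix Kronecker

noncomputable section

namespace SwitchedObserver

/-- A switching signal with values in `Fin N` and minimum dwell-time `T`: the mode `mode k` is
active on `(time k, time (k + 1)]`, where `time 0 = 0`, every dwell-time `time (k + 1) - time k`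
is at least `T`, and the mode changes at every `time k` with `1 ≤ k`. -/
structure SwitchingSignal (N : ℕ) (T : ℝ) where
  time : ℕ → ℝ
  mode : ℕ → Fin N
  time_zero : time 0 = 0
  dwell : ∀ k, T ≤ time (k + 1) - time k
  mode_ne : ∀ k, mode (k + 1) ≠ mode k

/-- `x` is a (left-continuous, Carathéodory) trajectory of the impulsive equation with impulse
times `tk`, jump matrices `J` and right-hand side `f`: it is continuous on the initial interval
`[-h, 0]`, satisfies `x' = f k` almost everywhere on `(tk k, tk (k + 1)]`, is absolutely
continuous there, and `x (tk k ⁺) = J k * x (tk k)`. -/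
def IsTrajectory {ι : Type*} [Fintype ι] (tk : ℕ → ℝ) (h : ℝ) (J : ℕ → Matrix ι ι ℝ)
    (f : ℕ → ℝ → ι → ℝ) (x : ℝ → ι → ℝ) : Prop :=
  ContinuousOn x (Icc (-h) 0) ∧
    ∀ k, ∀ t ∈ Ioc (tk k) (tk (k + 1)),
      IntervalIntegrable (f k) volume (tk k) t ∧
        x t = J k *ᵥ x (tk k) + ∫ s in (tk k)..t, f k s

/-- The data of a linear impulsive system with one constant delay and impulse times `tk`.
On `(tk k, tk (k + 1)]` it reads `x'(t) = A k t x(t) + G k t x(t - h) + E k t d(t)`, the jump at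
`tk k` is `J k`, and the performance output is `M x(t)`. -/
structure DelaySystem (ι κ : Type*) where
  tk : ℕ → ℝ
  A : ℕ → ℝ → Matrix ι ι ℝ
  G : ℕ → ℝ → Matrix ι ι ℝ
  E : ℕ → ℝ → Matrix ι κ ℝ
  J : ℕ → Matrix ι ι ℝ
  M : Matrix ι ι ℝ

/-- `x` is a solution of the delay system `S` with delay `h` and input `d`. -/
def DelaySystem.IsSolution {ι κ : Type*} [Fintype ι] [Fintype κ] (S : DelaySystem ι κ) (h : ℝ)
    (d : ℝ → κ → ℝ) (x : ℝ → ι → ℝ) : Prop :=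
  IsTrajectory S.tk h S.J
    (fun k t => S.A k t *ᵥ x t + S.G k t *ᵥ x (t - h) + S.E k t *ᵥ d t) x

/-- The sup-norm of the initial function of `x` on `[-h, 0]`. -/
def histNorm {ι : Type*} [Fintype ι] (h : ℝ) (x : ℝ → ι → ℝ) : ℝ :=
  sSup ((fun s => ‖x s‖) '' Icc (-h) 0)

/-- Asymptotic stability, with zero input, of a family of delay systems indexed by the switching
signals of minimum dwell-time `T`: stability (uniformly in the signal) and attractivity. -/
def AsymptoticallyStable {N : ℕ} {T : ℝ} {ι κ : Type*} [Fintype ι] [Fintype κ]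
    (S : SwitchingSignal N T → DelaySystem ι κ) (h : ℝ) : Prop :=
  (∀ ε > 0, ∃ η > 0, ∀ (σ : SwitchingSignal N T) (x : ℝ → ι → ℝ),
      (S σ).IsSolution h 0 x → histNorm h x < η → ∀ t ≥ 0, ‖x t‖ < ε) ∧
    ∀ (σ : SwitchingSignal N T) (x : ℝ → ι → ℝ),
      (S σ).IsSolution h 0 x → Tendsto x atTop (𝓝 0)

/-- The map from the input `d` to the performance output `M x` has an `L₁`-gain of at most `γ`
(uniformly in the switching signal): `‖M x‖_{L₁} ≤ γ ‖d‖_{L₁} + v (‖x₀‖)` for an increasing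
function `v` with `v 0 = 0` and `v s → ∞` as `s → ∞`. The `L₁`-norm of a vector-valued signal is
the integral over `(0, ∞)` of the sum of the absolute values of its components. -/
def HasL1Gain {N : ℕ} {T : ℝ} {ι κ : Type*} [Fintype ι] [Fintype κ]
    (S : SwitchingSignal N T → DelaySystem ι κ) (h γ : ℝ) : Prop :=
  ∃ v : ℝ → ℝ, StrictMonoOn v (Ici 0) ∧ v 0 = 0 ∧ Tendsto v atTop atTop ∧
    ∀ (σ : SwitchingSignal N T) (d : ℝ → κ → ℝ) (x : ℝ → ι → ℝ),
      IntegrableOn d (Ioi 0) → (S σ).IsSolution h d x →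
        IntegrableOn (fun t => (S σ).M *ᵥ x t) (Ioi 0) ∧
          ∫ t in Ioi (0 : ℝ), ∑ i, |((S σ).M *ᵥ x t) i| ≤
            γ * (∫ t in Ioi (0 : ℝ), ∑ j, |d t j|) + v (histNorm h x)

/-- The matrices of a switched system with `N` modes, state dimension `n`, input dimension `p`
and measurement dimension `q`: in mode `i`, `x'(t) = A i x(t) + G i x(t - h) + E i w(t)` and
`y(t) = C i x(t) + H i x(t - h) + F i w(t)`. -/
structure SwitchedPlant (N n p q : ℕ) where
  A : Fin N → Matrix (Fin n) (Fin n) ℝ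
  G : Fin N → Matrix (Fin n) (Fin n) ℝ
  E : Fin N → Matrix (Fin n) (Fin p) ℝ
  C : Fin N → Matrix (Fin q) (Fin n) ℝ
  H : Fin N → Matrix (Fin q) (Fin n) ℝ
  F : Fin N → Matrix (Fin q) (Fin p) ℝ

variable {N n p q : ℕ} {T : ℝ}

/-- The gain function in force at time `t` of the `k`-th interval: `L i (t - tₖ)` up to `tₖ + T`,
and `L i T` afterwards. -/
def timedGain (L : Fin N → ℝ → Matrix (Fin n) (Fin q) ℝ) (σ : SwitchingSignal N T)
    (i : Fin N) (k : ℕ) (t : ℝ) : Matrix (Fin n) (Fin q) ℝ :=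
  L i (min (t - σ.time k) T)

namespace SwitchedPlant

/-- The measured output at time `t` of the `k`-th interval. -/
def output (P : SwitchedPlant N n p q) (σ : SwitchingSignal N T) (h : ℝ) (w : ℝ → Fin p → ℝ)
    (x : ℝ → Fin n → ℝ) (k : ℕ) (t : ℝ) : Fin q → ℝ :=
  P.C (σ.mode k) *ᵥ x t + P.H (σ.mode k) *ᵥ x (t - h) + P.F (σ.mode k) *ᵥ w t

/-- `x` is a state trajectory of the switched system with input `w`. -/
def IsState (P : SwitchedPlant N n p q) (σ : SwitchingSignal N T) (h : ℝ) (w : ℝ → Fin p → ℝ)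
    (x : ℝ → Fin n → ℝ) : Prop :=
  IsTrajectory σ.time h (fun _ => 1)
    (fun k t => P.A (σ.mode k) *ᵥ x t + P.G (σ.mode k) *ᵥ x (t - h) + P.E (σ.mode k) *ᵥ w t) x

/-- `z` is a trajectory of the observer with gain functions `L` that is fed with the measured
output of `(w, x)` and with the input bound `w'`. -/
def IsObserverState (P : SwitchedPlant N n p q) (L : Fin N → ℝ → Matrix (Fin n) (Fin q) ℝ)
    (σ : SwitchingSignal N T) (h : ℝ) (w : ℝ → Fin p → ℝ) (x : ℝ → Fin n → ℝ)
    (w' : ℝ → Fin p → ℝ) (z : ℝ → Fin n → ℝ) : Prop :=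
  IsTrajectory σ.time h (fun _ => 1)
    (fun k t => P.A (σ.mode k) *ᵥ z t + P.G (σ.mode k) *ᵥ z (t - h) + P.E (σ.mode k) *ᵥ w' t +
      timedGain L σ (σ.mode k) k t *ᵥ (P.output σ h w x k t - P.output σ h w' z k t)) z

/-- The error dynamics of the observer, in the coordinates of the active mode. -/
def errorSystem (P : SwitchedPlant N n p q) (L : Fin N → ℝ → Matrix (Fin n) (Fin q) ℝ)
    (M : Matrix (Fin n) (Fin n) ℝ) (σ : SwitchingSignal N T) :
    DelaySystem (Fin n) (Fin p) where
  tk := σ.time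
  A k t := P.A (σ.mode k) - timedGain L σ (σ.mode k) k t * P.C (σ.mode k)
  G k t := P.G (σ.mode k) - timedGain L σ (σ.mode k) k t * P.H (σ.mode k)
  E k t := P.E (σ.mode k) - timedGain L σ (σ.mode k) k t * P.F (σ.mode k)
  J _ := 1
  M := M

/-- The error dynamics as an impulsive system with multiple jump maps: one block of dimension `n`
per mode, block-diagonal flow, and the jump `(bᵢ bⱼᵀ) ⊗ I` (block `j` is copied to block `i`, all
other blocks are reset to zero) at a switch from mode `j` to mode `i`. Block vectors are indexed by
(component, block), so that the Kronecker factors appear in the opposite order. The blocks have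
separate inputs; a common input `δ` is the block input all of whose blocks are `δ`. -/
def liftedErrorSystem (P : SwitchedPlant N n p q) (L : Fin N → ℝ → Matrix (Fin n) (Fin q) ℝ)
    (M : Matrix (Fin n) (Fin n) ℝ) (σ : SwitchingSignal N T) :
    DelaySystem (Fin n × Fin N) (Fin p × Fin N) where
  tk := σ.time
  A k t := Matrix.blockDiagonal fun i => P.A i - timedGain L σ i k t * P.C i
  G k t := Matrix.blockDiagonal fun i => P.G i - timedGain L σ i k t * P.H i
  E k t := Matrix.blockDiagonal fun i => P.E i - timedGain L σ i k t * P.F i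
  J k := match k with
    | 0 => 1
    | k + 1 => (1 : Matrix (Fin n) (Fin n) ℝ) ⊗ₖ
        Matrix.vecMulVec (Pi.single (σ.mode (k + 1)) (1 : ℝ)) (Pi.single (σ.mode k) (1 : ℝ))
  M := Matrix.blockDiagonal fun _ => M

/-- The gain functions `L` define interval observers whose error dynamics are positive,
asymptotically stable under minimum dwell-time `T`, and of `L₁`-gain at most `γ`. -/
structure SolvesObservationProblem (P : SwitchedPlant N n p q) (T h γ : ℝ)
    (M : Matrix (Fin n) (Fin n) ℝ) (L : Fin N → ℝ → Matrix (Fin n) (Fin q) ℝ) : Prop where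
  /-- The closed-loop state matrices are Metzler. -/
  metzler : ∀ i, ∀ τ ∈ Icc 0 T, ∀ a b, a ≠ b → 0 ≤ (P.A i - L i τ * P.C i) a b
  /-- The closed-loop input matrices are nonnegative. -/
  input_nonneg : ∀ i, ∀ τ ∈ Icc 0 T, ∀ a b, 0 ≤ (P.E i - L i τ * P.F i) a b
  /-- The closed-loop delay matrices are nonnegative. -/
  delay_nonneg : ∀ i, ∀ τ ∈ Icc 0 T, ∀ a b, 0 ≤ (P.G i - L i τ * P.H i) a b
  /-- The observers with input bounds `w₁ ≤ w ≤ w₂` and ordered initial functions enclose the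
  state. -/
  enclosure : ∀ (σ : SwitchingSignal N T) (w w₁ w₂ : ℝ → Fin p → ℝ) (x x₁ x₂ : ℝ → Fin n → ℝ),
    P.IsState σ h w x → P.IsObserverState L σ h w x w₁ x₁ → P.IsObserverState L σ h w x w₂ x₂ →
    (∀ t ≥ 0, w₁ t ≤ w t ∧ w t ≤ w₂ t) → (∀ s ∈ Icc (-h) 0, x₁ s ≤ x s ∧ x s ≤ x₂ s) →
    ∀ t ≥ 0, x₁ t ≤ x t ∧ x t ≤ x₂ t
  stable : AsymptoticallyStable (fun σ : SwitchingSignal N T => P.errorSystem L M σ) h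
  gain : HasL1Gain (fun σ : SwitchingSignal N T => P.errorSystem L M σ) h γ
  lifted_stable : AsymptoticallyStable (fun σ : SwitchingSignal N T => P.liftedErrorSystem L M σ) h
  lifted_gain : HasL1Gain (fun σ : SwitchingSignal N T => P.liftedErrorSystem L M σ) h γ

end SwitchedPlant

/-- The entrywise derivative at `τ` of a matrix function on `[0, T]` (one-sided at the ends). -/
def matrixDeriv (T : ℝ) (X : ℝ → Matrix (Fin n) (Fin n) ℝ) (τ : ℝ) : Matrix (Fin n) (Fin n) ℝ :=
  Matrix.of fun a b => derivWithin (fun s => X s a b) (Icc 0 T) τ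

end SwitchedObserver

end

namespace SwitchedObserver

/-- The asymmetric absolute value `max (s r) (-r)`: the absolute value for `s = 1` and the negative
part for `s = 0`. -/
noncomputable def asymAbs (s r : ℝ) : ℝ := max (s * r) (-r)

section asymAbs

variable {s : ℝ}

theorem asymAbs_zero : asymAbs s 0 = 0 := by simp [asymAbs]

theorem asymAbs_one (r : ℝ) : asymAbs 1 r = |r| := by simp [asymAbs, abs]

theorem asymAbs_nonneg (hs : 0 ≤ s) (r : ℝ) : 0 ≤ asymAbs s r := by
  rcases le_total 0 r with h | h
  · exact le_max_of_le_left (mul_nonneg hs h)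
  · exact le_max_of_le_right (neg_nonneg.2 h)

theorem asymAbs_zero_left_eq_zero {r : ℝ} (hr : 0 ≤ r) : asymAbs 0 r = 0 := by
  simp [asymAbs, hr]

theorem nonneg_of_asymAbs_nonpos {r : ℝ} (h : asymAbs s r ≤ 0) : 0 ≤ r := by
  have := (le_max_right (s * r) (-r)).trans h
  linarith

theorem asymAbs_mul (s : ℝ) {c : ℝ} (hc : 0 ≤ c) (r : ℝ) :
    asymAbs s (c * r) = c * asymAbs s r := by
  rw [asymAbs, asymAbs, mul_max_of_nonneg _ _ hc]
  congr 1 <;> ring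

theorem asymAbs_add_le (s r r' : ℝ) : asymAbs s (r + r') ≤ asymAbs s r + asymAbs s r' := by
  refine max_le ?_ ?_
  · rw [mul_add]; exact add_le_add (le_max_left _ _) (le_max_left _ _)
  · rw [neg_add]; exact add_le_add (le_max_right _ _) (le_max_right _ _)

theorem asymAbs_sum_le {ι : Type*} (t : Finset ι) (f : ι → ℝ) :
    asymAbs s (∑ i ∈ t, f i) ≤ ∑ i ∈ t, asymAbs s (f i) :=
  Finset.le_sum_of_subadditive (asymAbs s) asymAbs_zero.le (asymAbs_add_le s) t f

theorem asymAbs_sum_mul_le {ι : Type*} (t : Finset ι) {c : ι → ℝ} (hc : ∀ i ∈ t, 0 ≤ c i)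
    (f : ι → ℝ) : asymAbs s (∑ i ∈ t, c i * f i) ≤ ∑ i ∈ t, c i * asymAbs s (f i) :=
  (asymAbs_sum_le t _).trans (Finset.sum_le_sum fun i hi => (asymAbs_mul s (hc i hi) (f i)).le)

theorem continuous_asymAbs (s : ℝ) : Continuous (asymAbs s) := by
  unfold asymAbs; fun_prop

theorem lipschitzWith_asymAbs (s : ℝ) : LipschitzWith (max ‖s‖₊ 1) (asymAbs s) := by
  have h1 : LipschitzWith ‖s‖₊ fun r : ℝ => s * r :=
    LipschitzWith.of_dist_le_mul fun x y => by
      rw [Real.dist_eq, Real.dist_eq, ← mul_sub, abs_mul]; rfl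
  have h2 : LipschitzWith 1 fun r : ℝ => -r :=
    LipschitzWith.of_dist_le_mul fun x y => by simp [dist_neg_neg]
  exact h1.max h2

/-- Where `z' = a z + R`, the derivative of `asymAbs s ∘ z` is at most `a asymAbs s z + B` for every
bound `B` of `asymAbs s R`. -/
theorem deriv_asymAbs_comp_le (hs : 0 ≤ s) {z : ℝ → ℝ} {f D t a R B : ℝ} (hz : HasDerivAt z f t)
    (hD : HasDerivAt (fun τ => asymAbs s (z τ)) D t) (hf : f = a * z t + R)
    (hB : asymAbs s R ≤ B) : D ≤ a * asymAbs s (z t) + B := by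
  rcases lt_trichotomy (z t) 0 with h | h | h
  · have h1 : (fun τ => asymAbs s (z τ)) =ᶠ[𝓝 t] fun τ => -z τ := by
      filter_upwards [hz.continuousAt.eventually (gt_mem_nhds h)] with τ hτ
      exact max_eq_right (by nlinarith [hτ])
    have h2 : D = -f := hD.unique (hz.neg.congr_of_eventuallyEq h1)
    have h3 := (le_max_right (s * R) (-R)).trans hB
    have h4 : asymAbs s (z t) = -z t := h1.self_of_nhds
    rw [h4, h2, hf]
    linarith
  · have hmin : IsLocalMin (fun τ => asymAbs s (z τ)) t :=
      Eventually.of_forall fun τ => by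
        simp only [h, asymAbs_zero]; exact asymAbs_nonneg hs _
    rw [hmin.hasDerivAt_eq_zero hD, h, asymAbs_zero, mul_zero, zero_add]
    exact (asymAbs_nonneg hs R).trans hB
  · have h1 : (fun τ => asymAbs s (z τ)) =ᶠ[𝓝 t] fun τ => s * z τ := by
      filter_upwards [hz.continuousAt.eventually (lt_mem_nhds h)] with τ hτ
      exact max_eq_left (by nlinarith [hτ])
    have h2 : D = s * f := hD.unique ((hz.const_mul s).congr_of_eventuallyEq h1)
    have h3 := (le_max_left (s * R) (-R)).trans hB
    have h4 : asymAbs s (z t) = s * z t := h1.self_of_nhds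
    rw [h4, h2, hf]
    linarith [mul_add s (a * z t) R, mul_left_comm s a (z t)]

end asymAbs

section AbsolutelyContinuous

theorem _root_.AbsolutelyContinuousOnInterval.sub_le_integral {f g : ℝ → ℝ} {a b : ℝ}
    (hab : a ≤ b) (hf : AbsolutelyContinuousOnInterval f a b)
    (hg : IntervalIntegrable g volume a b)
    (h : ∀ᵐ t, t ∈ Ioo a b → ∀ D, HasDerivAt f D t → D ≤ g t) :
    f b - f a ≤ ∫ t in a..b, g t := by
  rw [← hf.integral_deriv_eq_sub]
  simp only [intervalIntegral.integral_of_le hab, integral_Ioc_eq_integral_Ioo]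
  refine setIntegral_mono_on_ae (hf.intervalIntegrable_deriv.1.mono_set Ioo_subset_Ioc_self)
    (hg.1.mono_set Ioo_subset_Ioc_self) measurableSet_Ioo ?_
  filter_upwards [h, hf.ae_differentiableAt] with t h1 h2 ht
  exact h1 ht _ (h2 (by rw [uIcc_of_le hab]; exact Ioo_subset_Icc_self ht)).hasDerivAt

theorem _root_.AbsolutelyContinuousOnInterval.finset_sum {ι : Type*} {f : ι → ℝ → ℝ} {a b : ℝ}
    (t : Finset ι) (hf : ∀ i ∈ t, AbsolutelyContinuousOnInterval (f i) a b) :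
    AbsolutelyContinuousOnInterval (fun x => ∑ i ∈ t, f i x) a b := by
  classical
  induction t using Finset.induction_on with
  | empty =>
    simpa using (LipschitzWith.const (0 : ℝ)).lipschitzOnWith.absolutelyContinuousOnInterval
  | insert i t hi ih =>
    simp only [Finset.sum_insert hi]
    exact (hf i (Finset.mem_insert_self i t)).fun_add
      (ih fun j hj => hf j (Finset.mem_insert_of_mem hj))

theorem _root_.LipschitzWith.comp_absolutelyContinuousOnInterval {φ f : ℝ → ℝ} {K : NNReal}
    {a b : ℝ} (hφ : LipschitzWith K φ) (hf : AbsolutelyContinuousOnInterval f a b) :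
    AbsolutelyContinuousOnInterval (fun x => φ (f x)) a b := by
  refine squeeze_zero (fun t => ?_) (fun t => ?_)
    (by simpa using Filter.Tendsto.const_mul (K : ℝ) hf)
  · exact Finset.sum_nonneg fun i _ => dist_nonneg
  · rw [Finset.mul_sum]
    exact Finset.sum_le_sum fun i _ => hφ.dist_le_mul _ _

theorem _root_.AbsolutelyContinuousOnInterval.congr_of_eqOn {f g : ℝ → ℝ} {a b : ℝ}
    (hf : AbsolutelyContinuousOnInterval f a b) (hfg : EqOn f g (uIcc a b)) :
    AbsolutelyContinuousOnInterval g a b := by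
  rw [absolutelyContinuousOnInterval_iff] at hf ⊢
  intro ε hε
  obtain ⟨δ, hδ, H⟩ := hf ε hε
  refine ⟨δ, hδ, fun E hE hlt => ?_⟩
  refine lt_of_eq_of_lt (Finset.sum_congr rfl fun i hi => ?_) (H E hE hlt)
  rw [hfg (hE.1 i hi).1, hfg (hE.1 i hi).2]

theorem _root_.IntervalIntegrable.absolutelyContinuousOnInterval_const_add {f : ℝ → ℝ} {a b : ℝ}
    (c : ℝ) (hf : IntervalIntegrable f volume a b) :
    AbsolutelyContinuousOnInterval (fun t => c + ∫ τ in a..t, f τ) a b :=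
  (LipschitzWith.const c).lipschitzOnWith.absolutelyContinuousOnInterval.fun_add
    (hf.absolutelyContinuousOnInterval_intervalIntegral left_mem_uIcc)

end AbsolutelyContinuous

/-- The column inequalities at one instant that make `∑ b, Q b |x b|` dissipative along
`x' = A x + G y + E d`, for weights `Q` with derivative `Q'`. -/
structure FlowBound {ι κ : Type*} [Fintype ι] (A G : Matrix ι ι ℝ) (E : Matrix ι κ ℝ)
    (Q Q' u m : ι → ℝ) (γ : ℝ) : Prop where
  weight_nonneg : ∀ i, 0 ≤ Q i
  metzler : ∀ i j, i ≠ j → 0 ≤ A i j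
  delay_nonneg : ∀ i j, 0 ≤ G i j
  input_nonneg : ∀ i j, 0 ≤ E i j
  state_column : ∀ j, Q' j + ∑ i, Q i * A i j + u j + m j ≤ 0
  delay_column : ∀ j, ∑ i, Q i * G i j ≤ u j
  input_column : ∀ j, ∑ i, Q i * E i j ≤ γ

namespace FlowBound

variable {ι κ : Type*} [Fintype ι] {A G : Matrix ι ι ℝ} {E : Matrix ι κ ℝ}
  {Q Q' u m : ι → ℝ} {γ : ℝ}

/-- Decreasing the weight of one component by `θ ≤ Q a` with `θ' = (α / c) θ` preserves the column
inequalities. -/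
theorem perturb [DecidableEq ι] (h : FlowBound A G E Q Q' u m γ) {c α θ : ℝ} (hc : 0 < c) (a : ι)
    (hcQ : c ≤ Q a) (hα : 0 ≤ α) (hA : -α ≤ Q a * A a a) (hθ : 0 ≤ θ) (hθc : θ ≤ c) :
    FlowBound A G E (Q - Pi.single a θ) (Q' - Pi.single a (α / c * θ)) u m γ where
  weight_nonneg i := by
    rcases eq_or_ne i a with rfl | hi
    · simpa using hθc.trans hcQ
    · simpa [hi] using h.weight_nonneg i
  metzler := h.metzler
  delay_nonneg := h.delay_nonneg
  input_nonneg := h.input_nonneg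
  state_column j := by
    have h1 := h.state_column j
    simp only [Pi.sub_apply, sub_mul, Finset.sum_sub_distrib, Pi.single_apply, ite_mul, zero_mul,
      Finset.sum_ite_eq', Finset.mem_univ, if_true]
    rcases eq_or_ne j a with rfl | hj
    · simp only [if_true]
      have h2 : -(α / c) ≤ A j j := by
        rw [← neg_div, div_le_iff₀ hc]
        rcases le_total 0 (A j j) with hj | hj
        · exact (neg_nonpos.2 hα).trans (mul_nonneg hj hc.le)
        · rw [mul_comm]
          exact hA.trans (mul_le_mul_of_nonpos_right hcQ hj)
      nlinarith [mul_le_mul_of_nonneg_left h2 hθ]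
    · have h2 := mul_nonneg hθ (h.metzler a j hj.symm)
      rw [if_neg hj]
      linarith
  delay_column j := by
    have h1 := h.delay_column j
    have h2 := mul_nonneg hθ (h.delay_nonneg a j)
    simp only [Pi.sub_apply, sub_mul, Finset.sum_sub_distrib, Pi.single_apply, ite_mul, zero_mul,
      Finset.sum_ite_eq', Finset.mem_univ, if_true]
    linarith
  input_column j := by
    have h1 := h.input_column j
    have h2 := mul_nonneg hθ (h.input_nonneg a j)
    simp only [Pi.sub_apply, sub_mul, Finset.sum_sub_distrib, Pi.single_apply, ite_mul, zero_mul,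
      Finset.sum_ite_eq', Finset.mem_univ, if_true]
    linarith

variable [Fintype κ]

theorem sum_deriv_le (h : FlowBound A G E Q Q' u m γ) {D σ η : ι → ℝ} {δ : κ → ℝ}
    (hσ : ∀ i, 0 ≤ σ i) (hη : ∀ i, 0 ≤ η i) (hδ : ∀ j, 0 ≤ δ j)
    (hD : ∀ i, D i ≤ ∑ j, A i j * σ j + (∑ j, G i j * η j + ∑ j, E i j * δ j)) :
    ∑ i, (Q' i * σ i + Q i * D i) ≤
      -∑ i, u i * σ i - ∑ i, m i * σ i + ∑ i, u i * η i + γ * ∑ j, δ j := by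
  have h1 : ∑ i, Q i * D i ≤ ∑ j, (∑ i, Q i * A i j) * σ j + (∑ j, (∑ i, Q i * G i j) * η j +
      ∑ j, (∑ i, Q i * E i j) * δ j) := by
    calc ∑ i, Q i * D i
        ≤ ∑ i, Q i * (∑ j, A i j * σ j + (∑ j, G i j * η j + ∑ j, E i j * δ j)) :=
          Finset.sum_le_sum fun i _ => mul_le_mul_of_nonneg_left (hD i) (h.weight_nonneg i)
      _ = _ := by
          simp only [mul_add, Finset.sum_add_distrib, Finset.mul_sum, Finset.sum_mul, mul_assoc]
          rw [Finset.sum_comm (f := fun i j => Q i * (A i j * σ j)),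
            Finset.sum_comm (f := fun i j => Q i * (G i j * η j)),
            Finset.sum_comm (f := fun i j => Q i * (E i j * δ j))]
  have h2 : ∑ j, (Q' j + ∑ i, Q i * A i j + u j + m j) * σ j ≤ 0 :=
    Finset.sum_nonpos fun j _ => mul_nonpos_of_nonpos_of_nonneg (h.state_column j) (hσ j)
  have h3 : ∑ j, (∑ i, Q i * G i j) * η j ≤ ∑ j, u j * η j :=
    Finset.sum_le_sum fun j _ => mul_le_mul_of_nonneg_right (h.delay_column j) (hη j)
  have h4 : ∑ j, (∑ i, Q i * E i j) * δ j ≤ γ * ∑ j, δ j := by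
    rw [Finset.mul_sum]
    exact Finset.sum_le_sum fun j _ => mul_le_mul_of_nonneg_right (h.input_column j) (hδ j)
  simp only [add_mul, Finset.sum_add_distrib] at h2 ⊢
  linarith

/-- Dissipation inequality on an interval without impulses. -/
theorem sub_le_integral {a b s : ℝ} (hs : 0 ≤ s) (hab : a ≤ b)
    {A G : ℝ → Matrix ι ι ℝ} {E : ℝ → Matrix ι κ ℝ} {Q Q' z y : ℝ → ι → ℝ} {d : ℝ → κ → ℝ}
    (hQ : ∀ i, AbsolutelyContinuousOnInterval (fun t => Q t i) a b)
    (hz : ∀ i, AbsolutelyContinuousOnInterval (fun t => z t i) a b)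
    (hQ' : ∀ᵐ t, t ∈ Ioo a b → (∀ i, HasDerivAt (fun t => Q t i) (Q' t i) t) ∧
      FlowBound (A t) (G t) (E t) (Q t) (Q' t) u m γ)
    (hz' : ∀ᵐ t, t ∈ Ioo a b → ∀ i,
      HasDerivAt (fun t => z t i) ((A t *ᵥ z t + G t *ᵥ y t + E t *ᵥ d t) i) t)
    (hy : ∀ i, IntervalIntegrable (fun t => asymAbs s (y t i)) volume a b)
    (hd : ∀ j, IntervalIntegrable (fun t => asymAbs s (d t j)) volume a b) :
    ∑ i, Q b i * asymAbs s (z b i) - ∑ i, Q a i * asymAbs s (z a i) ≤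
      ∫ t in a..b, (-∑ i, u i * asymAbs s (z t i) - ∑ i, m i * asymAbs s (z t i) +
        ∑ i, u i * asymAbs s (y t i) + γ * ∑ j, asymAbs s (d t j)) := by
  have hzs : ∀ i, AbsolutelyContinuousOnInterval (fun t => asymAbs s (z t i)) a b := fun i =>
    (lipschitzWith_asymAbs s).comp_absolutelyContinuousOnInterval (hz i)
  have hsum : ∀ (v : ι → ℝ),
      IntervalIntegrable (fun t => ∑ i, v i * asymAbs s (z t i)) volume a b := fun v =>
    (AbsolutelyContinuousOnInterval.finset_sum _ fun i _ =>
      (hzs i).const_mul (v i)).continuousOn.intervalIntegrable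
  refine AbsolutelyContinuousOnInterval.sub_le_integral hab
    (f := fun t => ∑ i, Q t i * asymAbs s (z t i))
    (AbsolutelyContinuousOnInterval.finset_sum _ fun i _ => (hQ i).fun_mul (hzs i)) ?_ ?_
  · refine (((hsum u).neg.sub (hsum m)).add ?_).add (IntervalIntegrable.const_mul ?_ γ)
    · have := IntervalIntegrable.sum Finset.univ (f := fun i t => u i * asymAbs s (y t i))
        fun i _ => (hy i).const_mul (u i)
      simpa only [Finset.sum_fn] using this
    · have := IntervalIntegrable.sum Finset.univ (f := fun j t => asymAbs s (d t j))
        fun j _ => hd j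
      simpa only [Finset.sum_fn] using this
  · have hdiff : ∀ᵐ t, ∀ i, t ∈ uIcc a b → DifferentiableAt ℝ (fun t => asymAbs s (z t i)) t :=
      ae_all_iff.2 fun i => (hzs i).ae_differentiableAt
    filter_upwards [hQ', hz', hdiff] with t h1 h2 h3 ht D hD
    obtain ⟨h1, hflow⟩ := h1 ht
    replace h2 := h2 ht
    have h3 : ∀ i, HasDerivAt (fun t => asymAbs s (z t i))
        (deriv (fun t => asymAbs s (z t i)) t) t := fun i =>
      (h3 i (by rw [uIcc_of_le hab]; exact Ioo_subset_Icc_self ht)).hasDerivAt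
    have h4 := HasDerivAt.fun_sum fun i (_ : i ∈ Finset.univ) => (h1 i).mul (h3 i)
    rw [hD.unique h4]
    refine hflow.sum_deriv_le (fun i => asymAbs_nonneg hs _) (fun i => asymAbs_nonneg hs _)
      (fun i => asymAbs_nonneg hs _) fun i => ?_
    classical
    have h5 : (A t *ᵥ z t) i = A t i i * z t i + ∑ j ∈ Finset.univ.erase i, A t i j * z t j :=
      (Finset.add_sum_erase _ (fun j => A t i j * z t j) (Finset.mem_univ i)).symm
    rw [← Finset.add_sum_erase _ (fun j => A t i j * asymAbs s (z t j)) (Finset.mem_univ i),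
      add_assoc]
    refine deriv_asymAbs_comp_le hs (h2 i) (h3 i)
      (R := ∑ j ∈ Finset.univ.erase i, A t i j * z t j + ((G t *ᵥ y t) i + (E t *ᵥ d t) i)) ?_ ?_
    · simp only [Pi.add_apply, h5]; ring
    · refine (asymAbs_add_le s _ _).trans (add_le_add ?_ ((asymAbs_add_le s _ _).trans
        (add_le_add ?_ ?_)))
      · exact asymAbs_sum_mul_le _ (fun j hj =>
          hflow.metzler i j (Finset.ne_of_mem_erase hj).symm) _
      · exact asymAbs_sum_mul_le _ (fun j _ => hflow.delay_nonneg i j) _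
      · exact asymAbs_sum_mul_le _ (fun j _ => hflow.input_nonneg i j) _

end FlowBound

namespace DelaySystem

variable {ι κ : Type*}

/-- The impulse times of `S` start at `0` and are at least `T > 0` apart. -/
structure HasDwellTime (S : DelaySystem ι κ) (T : ℝ) : Prop where
  pos : 0 < T
  tk_zero : S.tk 0 = 0
  le_sub : ∀ k, T ≤ S.tk (k + 1) - S.tk k

namespace HasDwellTime

variable {S : DelaySystem ι κ} {T : ℝ}

theorem tk_lt (hS : S.HasDwellTime T) (k : ℕ) : S.tk k < S.tk (k + 1) := by
  linarith [hS.pos, hS.le_sub k]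

theorem strictMono (hS : S.HasDwellTime T) : StrictMono S.tk := strictMono_nat_of_lt_succ hS.tk_lt

theorem tk_nonneg (hS : S.HasDwellTime T) (k : ℕ) : 0 ≤ S.tk k :=
  hS.tk_zero.symm.le.trans (hS.strictMono.monotone k.zero_le)

theorem tendsto_tk (hS : S.HasDwellTime T) : Tendsto S.tk atTop atTop := by
  have h1 : ∀ k : ℕ, k * T ≤ S.tk k := by
    intro k
    induction k with
    | zero => simp [hS.tk_zero]
    | succ k ih => push_cast; linarith [hS.le_sub k]
  exact tendsto_atTop_mono h1 (tendsto_natCast_atTop_atTop.atTop_mul_const hS.pos)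

theorem exists_mem_Ioc (hS : S.HasDwellTime T) {t : ℝ} (ht : 0 < t) :
    ∃ k, t ∈ Ioc (S.tk k) (S.tk (k + 1)) := by
  classical
  have h1 : ∃ k, t ≤ S.tk k := (hS.tendsto_tk.eventually_ge_atTop t).exists
  obtain ⟨k, hk⟩ : ∃ k, Nat.find h1 = k + 1 := by
    refine Nat.exists_eq_succ_of_ne_zero fun h => ?_
    have := Nat.find_spec h1
    rw [h, hS.tk_zero] at this
    linarith
  refine ⟨k, not_le.1 (Nat.find_min h1 (by omega)), ?_⟩
  rw [← hk]
  exact Nat.find_spec h1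

theorem lt_of_mem_Ioc (hS : S.HasDwellTime T) {t : ℝ} {k l : ℕ}
    (ht : t ∈ Ioc (S.tk k) (S.tk (k + 1))) (hl : t ≤ S.tk l) : k < l :=
  hS.strictMono.lt_iff_lt.1 (ht.1.trans_le hl)

theorem le_of_mem_Ioc (hS : S.HasDwellTime T) {t : ℝ} {k l : ℕ}
    (ht : t ∈ Ioc (S.tk k) (S.tk (k + 1))) (hl : S.tk l < t) : l ≤ k :=
  Nat.lt_succ_iff.1 (hS.strictMono.lt_iff_lt.1 (hl.trans_le ht.2))

end HasDwellTime

variable [Fintype ι] [Fintype κ]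

/-- The right-hand side of `S` on its `k`-th interval, along `x`. -/
def rhs (S : DelaySystem ι κ) (h : ℝ) (d : ℝ → κ → ℝ) (x : ℝ → ι → ℝ) (k : ℕ) (t : ℝ) : ι → ℝ :=
  S.A k t *ᵥ x t + S.G k t *ᵥ x (t - h) + S.E k t *ᵥ d t

/-- The continuous extension to `[tk k, tk (k + 1)]` of a solution on `(tk k, tk (k + 1)]`; its
value at `tk k` is the state after the jump. -/
noncomputable def flowState (S : DelaySystem ι κ) (h : ℝ) (d : ℝ → κ → ℝ) (x : ℝ → ι → ℝ) (k : ℕ)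
    (t : ℝ) : ι → ℝ :=
  S.J k *ᵥ x (S.tk k) + ∫ τ in (S.tk k)..t, S.rhs h d x k τ

theorem flowState_tk (S : DelaySystem ι κ) (h : ℝ) (d : ℝ → κ → ℝ) (x : ℝ → ι → ℝ) (k : ℕ) :
    S.flowState h d x k (S.tk k) = S.J k *ᵥ x (S.tk k) := by
  simp [flowState]

namespace IsSolution

variable {S : DelaySystem ι κ} {T h : ℝ} {d : ℝ → κ → ℝ} {x : ℝ → ι → ℝ}

theorem eq_flowState (hx : S.IsSolution h d x) {k : ℕ} {t : ℝ}
    (ht : t ∈ Ioc (S.tk k) (S.tk (k + 1))) : x t = S.flowState h d x k t :=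
  (hx.2 k t ht).2

theorem intervalIntegrable_rhs (hx : S.IsSolution h d x) (hS : S.HasDwellTime T) (k : ℕ) :
    IntervalIntegrable (S.rhs h d x k) volume (S.tk k) (S.tk (k + 1)) :=
  (hx.2 k _ (right_mem_Ioc.2 (hS.tk_lt k))).1

theorem intervalIntegrable_rhs_apply (hx : S.IsSolution h d x) (hS : S.HasDwellTime T) (k : ℕ)
    (i : ι) : IntervalIntegrable (fun t => S.rhs h d x k t i) volume (S.tk k) (S.tk (k + 1)) := by
  have := hx.intervalIntegrable_rhs hS k
  exact ⟨this.1.eval i, this.2.eval i⟩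

theorem flowState_apply (hx : S.IsSolution h d x) (hS : S.HasDwellTime T) {k : ℕ} {t : ℝ}
    (ht : t ∈ Icc (S.tk k) (S.tk (k + 1))) (i : ι) :
    S.flowState h d x k t i =
      (S.J k *ᵥ x (S.tk k)) i + ∫ τ in (S.tk k)..t, S.rhs h d x k τ i := by
  have h1 : IntervalIntegrable (S.rhs h d x k) volume (S.tk k) t :=
    (hx.intervalIntegrable_rhs hS k).mono_set (by
      rw [uIcc_of_le ht.1, uIcc_of_le (hS.tk_lt k).le]; exact Icc_subset_Icc_right ht.2)
  have h2 := (ContinuousLinearMap.proj (R := ℝ) (φ := fun _ : ι => ℝ) i).intervalIntegral_comp_comm h1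
  simp only [ContinuousLinearMap.proj_apply] at h2
  rw [flowState, Pi.add_apply, h2]

theorem flowState_absolutelyContinuous (hx : S.IsSolution h d x) (hS : S.HasDwellTime T) (k : ℕ)
    (i : ι) : AbsolutelyContinuousOnInterval (fun t => S.flowState h d x k t i)
      (S.tk k) (S.tk (k + 1)) := by
  refine ((hx.intervalIntegrable_rhs_apply hS k i).absolutelyContinuousOnInterval_const_add
    ((S.J k *ᵥ x (S.tk k)) i)).congr_of_eqOn fun t ht => ?_
  rw [uIcc_of_le (hS.tk_lt k).le] at ht
  exact (hx.flowState_apply hS ht i).symm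

theorem continuousOn_flowState (hx : S.IsSolution h d x) (hS : S.HasDwellTime T) (k : ℕ) :
    ContinuousOn (S.flowState h d x k) (Icc (S.tk k) (S.tk (k + 1))) :=
  continuousOn_pi.2 fun i => by
    simpa only [uIcc_of_le (hS.tk_lt k).le] using
      (hx.flowState_absolutelyContinuous hS k i).continuousOn

theorem hasDerivAt_flowState (hx : S.IsSolution h d x) (hS : S.HasDwellTime T) (k : ℕ) :
    ∀ᵐ t, t ∈ Ioo (S.tk k) (S.tk (k + 1)) → ∀ i, HasDerivAt (fun t => S.flowState h d x k t i)
      ((S.A k t *ᵥ S.flowState h d x k t + S.G k t *ᵥ x (t - h) + S.E k t *ᵥ d t) i) t := by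
  have h1 := ae_all_iff.2 fun i => (hx.intervalIntegrable_rhs_apply hS k i).ae_hasDerivAt_integral
  filter_upwards [h1] with t h1 ht i
  have htI : t ∈ uIcc (S.tk k) (S.tk (k + 1)) := by
    rw [uIcc_of_le (hS.tk_lt k).le]; exact Ioo_subset_Icc_self ht
  rw [← hx.eq_flowState (Ioo_subset_Ioc_self ht)]
  refine ((h1 i htI _ left_mem_uIcc).const_add ((S.J k *ᵥ x (S.tk k)) i)).congr_of_eventuallyEq ?_
  filter_upwards [Ioo_mem_nhds ht.1 ht.2] with τ hτ
  exact hx.flowState_apply hS (Ioo_subset_Icc_self hτ) i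

theorem intervalIntegrable_comp_tk (hx : S.IsSolution h d x) (hS : S.HasDwellTime T) (hh : 0 ≤ h)
    {ψ : (ι → ℝ) → ℝ} (hψ : Continuous ψ) (k : ℕ) :
    IntervalIntegrable (fun t => ψ (x t)) volume (-h) (S.tk k) := by
  induction k with
  | zero =>
    rw [hS.tk_zero]
    refine ContinuousOn.intervalIntegrable ?_
    rw [uIcc_of_le (by linarith)]
    exact hψ.comp_continuousOn hx.1
  | succ k ih =>
    refine ih.trans ?_
    have h1 : IntervalIntegrable (fun t => ψ (S.flowState h d x k t)) volume
        (S.tk k) (S.tk (k + 1)) := by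
      refine ContinuousOn.intervalIntegrable ?_
      rw [uIcc_of_le (hS.tk_lt k).le]
      exact hψ.comp_continuousOn (hx.continuousOn_flowState hS k)
    refine h1.congr fun t ht => ?_
    rw [uIoc_of_le (hS.tk_lt k).le] at ht
    exact congrArg ψ (hx.eq_flowState ht).symm

theorem intervalIntegrable_comp (hx : S.IsSolution h d x) (hS : S.HasDwellTime T) (hh : 0 ≤ h)
    {ψ : (ι → ℝ) → ℝ} (hψ : Continuous ψ) {a b : ℝ} (ha : -h ≤ a) (hb : -h ≤ b) :
    IntervalIntegrable (fun t => ψ (x t)) volume a b := by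
  obtain ⟨k, hk⟩ := (hS.tendsto_tk.eventually_ge_atTop (max a b)).exists
  refine (hx.intervalIntegrable_comp_tk hS hh hψ k).mono_set ?_
  have hka := (le_max_left a b).trans hk
  have hkb := (le_max_right a b).trans hk
  rw [uIcc_of_le (ha.trans hka)]
  exact uIcc_subset_Icc ⟨ha, hka⟩ ⟨hb, hkb⟩

theorem continuous_sum_asymAbs (s : ℝ) (v : ι → ℝ) :
    Continuous fun z : ι → ℝ => ∑ i, v i * asymAbs s (z i) :=
  continuous_finsetSum _ fun i _ =>
    continuous_const.mul ((continuous_asymAbs s).comp (continuous_apply i))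

/-- Lyapunov–Krasovskii inequality between two instants of one interval without impulses, for
weights `Q` satisfying the column inequalities. -/
theorem functional_le {s γ a b : ℝ} {u m : ι → ℝ} {Q Q' : ℝ → ι → ℝ} {k : ℕ}
    (hx : S.IsSolution h d x) (hS : S.HasDwellTime T) (hh : 0 ≤ h) (hs : 0 ≤ s)
    (ha : S.tk k ≤ a) (hab : a ≤ b) (hb : b ≤ S.tk (k + 1))
    (hQ : ∀ i, AbsolutelyContinuousOnInterval (fun t => Q t i) a b)
    (hQ' : ∀ᵐ t, t ∈ Ioo a b → (∀ i, HasDerivAt (fun t => Q t i) (Q' t i) t) ∧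
      FlowBound (S.A k t) (S.G k t) (S.E k t) (Q t) (Q' t) u m γ)
    (hd : ∀ j, IntervalIntegrable (fun t => asymAbs s (d t j)) volume a b) :
    ∑ i, Q b i * asymAbs s (S.flowState h d x k b i) +
        (∫ t in (b - h)..b, ∑ i, u i * asymAbs s (x t i)) +
        (∫ t in a..b, ∑ i, m i * asymAbs s (x t i)) ≤
      ∑ i, Q a i * asymAbs s (S.flowState h d x k a i) +
        (∫ t in (a - h)..a, ∑ i, u i * asymAbs s (x t i)) +
        γ * ∫ t in a..b, ∑ j, asymAbs s (d t j) := by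
  have h0 : 0 ≤ a := (hS.tk_nonneg k).trans ha
  have hsub : uIcc a b ⊆ uIcc (S.tk k) (S.tk (k + 1)) := by
    rw [uIcc_of_le hab, uIcc_of_le (hS.tk_lt k).le]; exact Icc_subset_Icc ha hb
  have hsubo : Ioo a b ⊆ Ioo (S.tk k) (S.tk (k + 1)) := Ioo_subset_Ioo ha hb
  have hint : ∀ (v : ι → ℝ) {a b : ℝ}, -h ≤ a → -h ≤ b →
      IntervalIntegrable (fun t => ∑ i, v i * asymAbs s (x t i)) volume a b := fun v _ _ h1 h2 =>
    hx.intervalIntegrable_comp hS hh (continuous_sum_asymAbs s v) h1 h2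
  have hy : ∀ {ψ : (ι → ℝ) → ℝ}, Continuous ψ →
      IntervalIntegrable (fun t => ψ (x (t - h))) volume a b := fun hψ => by
    have := (hx.intervalIntegrable_comp hS hh hψ (a := a - h) (b := b - h)
      (by linarith) (by linarith)).comp_sub_right h
    simpa only [sub_add_cancel] using this
  have h1 := FlowBound.sub_le_integral hs hab hQ
    (fun i => (hx.flowState_absolutelyContinuous hS k i).mono hsub) hQ'
    (by filter_upwards [hx.hasDerivAt_flowState hS k] with t ht h2 using ht (hsubo h2))
    (fun i => hy ((continuous_asymAbs s).comp (continuous_apply i))) hd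
  have h2 : ∫ t in a..b, (-∑ i, u i * asymAbs s (S.flowState h d x k t i) -
        ∑ i, m i * asymAbs s (S.flowState h d x k t i) +
        ∑ i, u i * asymAbs s (x (t - h) i) + γ * ∑ j, asymAbs s (d t j)) =
      ∫ t in a..b, (-∑ i, u i * asymAbs s (x t i) - ∑ i, m i * asymAbs s (x t i) +
        ∑ i, u i * asymAbs s (x (t - h) i) + γ * ∑ j, asymAbs s (d t j)) := by
    refine intervalIntegral.integral_congr_ae (ae_of_all _ fun t ht => ?_)
    rw [uIoc_of_le hab] at ht
    rw [hx.eq_flowState ⟨ha.trans_lt ht.1, ht.2.trans hb⟩]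
  have hdsum : IntervalIntegrable (fun t => ∑ j, asymAbs s (d t j)) volume a b := by
    simpa only [Finset.sum_fn] using
      IntervalIntegrable.sum Finset.univ (f := fun j t => asymAbs s (d t j)) fun j _ => hd j
  have hua := hint u (a := a) (b := b) (by linarith) (by linarith)
  have hma := hint m (a := a) (b := b) (by linarith) (by linarith)
  have hua' := hy (continuous_sum_asymAbs s u)
  have huan : IntervalIntegrable (fun t => -∑ i, u i * asymAbs s (x t i)) volume a b := hua.neg
  rw [h2, intervalIntegral.integral_add ((huan.sub hma).add hua') (hdsum.const_mul γ),
    intervalIntegral.integral_add (huan.sub hma) hua',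
    intervalIntegral.integral_sub huan hma, intervalIntegral.integral_neg,
    intervalIntegral.integral_const_mul,
    intervalIntegral.integral_comp_sub_right (fun t => ∑ i, u i * asymAbs s (x t i)) h] at h1
  have h3 := intervalIntegral.integral_interval_sub_interval_comm
    (hint u (a := b - h) (b := b) (by linarith) (by linarith))
    (hint u (a := a - h) (b := a) (by linarith) (by linarith))
    (hint u (a := b - h) (b := a - h) (by linarith) (by linarith))
  rw [intervalIntegral.integral_symm (a - h) (b - h), intervalIntegral.integral_symm a b] at h3
  linarith

end IsSolution

end DelaySystem

/-- Data certifying dissipation of `S`: weights `P k t`, bounded between `c` and `C`, that satisfy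
the column inequalities along the flow and decrease by `ε` at the impulses. -/
structure DissipationCertificate {ι κ : Type*} [Fintype ι] (S : DelaySystem ι κ)
    (T c C α ε γ : ℝ) (u m : ι → ℝ) (P P' : ℕ → ℝ → ι → ℝ) : Prop where
  dwell : S.HasDwellTime T
  c_pos : 0 < c
  C_nonneg : 0 ≤ C
  ε_pos : 0 < ε
  α_nonneg : 0 ≤ α
  u_nonneg : ∀ i, 0 ≤ u i
  weight_ac : ∀ k i, AbsolutelyContinuousOnInterval (fun t => P k t i) (S.tk k) (S.tk (k + 1))
  flow : ∀ k, ∀ᵐ t, t ∈ Ioo (S.tk k) (S.tk (k + 1)) →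
    (∀ i, HasDerivAt (fun t => P k t i) (P' k t i) t) ∧
      FlowBound (S.A k t) (S.G k t) (S.E k t) (P k t) (P' k t) u m γ
  diag_ge : ∀ k, ∀ t ∈ Ioo (S.tk k) (S.tk (k + 1)), ∀ i, -α ≤ P k t i * S.A k t i i
  weight_ge : ∀ k, ∀ t ∈ Icc (S.tk k) (S.tk (k + 1)), ∀ i, c ≤ P k t i
  weight_le : ∀ k, ∀ t ∈ Icc (S.tk k) (S.tk (k + 1)), ∀ i, P k t i ≤ C
  jump_zero : ∀ v, S.J 0 *ᵥ v = v
  jump_nonneg : ∀ k i j, 0 ≤ S.J (k + 1) i j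
  jump : ∀ k j, ∑ i, P (k + 1) (S.tk (k + 1)) i * S.J (k + 1) i j + ε ≤ P k (S.tk (k + 1)) j
  output : ∀ j, ∑ i, |S.M i j| ≤ m j

theorem norm_le_histNorm {ι : Type*} [Fintype ι] {h t : ℝ} {x : ℝ → ι → ℝ}
    (hx : ContinuousOn x (Icc (-h) 0)) (ht : t ∈ Icc (-h) 0) : ‖x t‖ ≤ histNorm h x :=
  le_csSup (isCompact_Icc.image_of_continuousOn hx.norm).bddAbove (mem_image_of_mem _ ht)

theorem norm_le_sum_abs {ι : Type*} [Fintype ι] (v : ι → ℝ) : ‖v‖ ≤ ∑ i, |v i| :=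
  (pi_norm_le_iff_of_nonneg (Finset.sum_nonneg fun i _ => abs_nonneg (v i))).2 fun i =>
    Finset.single_le_sum (f := fun i => |v i|) (fun i _ => abs_nonneg (v i)) (Finset.mem_univ i)

/-- Lyapunov–Krasovskii functional along a solution, on the `k`-th interval. -/
noncomputable def DelaySystem.storage {ι κ : Type*} [Fintype ι] [Fintype κ] (S : DelaySystem ι κ)
    (P : ℕ → ℝ → ι → ℝ) (u : ι → ℝ) (s h : ℝ) (d : ℝ → κ → ℝ) (x : ℝ → ι → ℝ) (k : ℕ) (t : ℝ) : ℝ :=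
  ∑ i, P k t i * asymAbs s (S.flowState h d x k t i) +
    ∫ τ in (t - h)..t, ∑ i, u i * asymAbs s (x τ i)

namespace DissipationCertificate

variable {ι κ : Type*} [Fintype ι] {S : DelaySystem ι κ} {T c C α ε γ h s : ℝ}
  {u m : ι → ℝ} {P P' : ℕ → ℝ → ι → ℝ} {d : ℝ → κ → ℝ} {x : ℝ → ι → ℝ}

theorem m_nonneg (cert : DissipationCertificate S T c C α ε γ u m P P') (i : ι) : 0 ≤ m i :=
  (Finset.sum_nonneg fun _ _ => abs_nonneg _).trans (cert.output i)

theorem integral_output_nonneg (cert : DissipationCertificate S T c C α ε γ u m P P')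
    (hs : 0 ≤ s) {t : ℝ} (ht : 0 ≤ t) :
    0 ≤ ∫ t in (0 : ℝ)..t, ∑ i, m i * asymAbs s (x t i) :=
  intervalIntegral.integral_nonneg ht fun _ _ =>
    Finset.sum_nonneg fun i _ => mul_nonneg (cert.m_nonneg i) (asymAbs_nonneg hs _)

variable [Fintype κ]

theorem sum_le_storage (cert : DissipationCertificate S T c C α ε γ u m P P') (hh : 0 ≤ h)
    (hs : 0 ≤ s) {k : ℕ} {t : ℝ} (ht : t ∈ Icc (S.tk k) (S.tk (k + 1))) :
    c * ∑ i, asymAbs s (S.flowState h d x k t i) ≤ S.storage P u s h d x k t := by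
  refine le_add_of_le_of_nonneg ?_ ?_
  · rw [Finset.mul_sum]
    exact Finset.sum_le_sum fun i _ =>
      mul_le_mul_of_nonneg_right (cert.weight_ge k t ht i) (asymAbs_nonneg hs _)
  · exact intervalIntegral.integral_nonneg (by linarith) fun _ _ =>
      Finset.sum_nonneg fun i _ => mul_nonneg (cert.u_nonneg i) (asymAbs_nonneg hs _)

theorem storage_nonneg (cert : DissipationCertificate S T c C α ε γ u m P P') (hh : 0 ≤ h)
    (hs : 0 ≤ s) {k : ℕ} {t : ℝ} (ht : t ∈ Icc (S.tk k) (S.tk (k + 1))) :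
    0 ≤ S.storage P u s h d x k t :=
  (mul_nonneg cert.c_pos.le (Finset.sum_nonneg fun _ _ => asymAbs_nonneg hs _)).trans
    (cert.sum_le_storage hh hs ht)

theorem storage_flow_le (cert : DissipationCertificate S T c C α ε γ u m P P')
    (hx : S.IsSolution h d x) (hh : 0 ≤ h) (hs : 0 ≤ s) {k : ℕ} {a b : ℝ} (ha : S.tk k ≤ a)
    (hab : a ≤ b) (hb : b ≤ S.tk (k + 1))
    (hd : ∀ j, IntervalIntegrable (fun t => asymAbs s (d t j)) volume a b) :
    S.storage P u s h d x k b + (∫ t in a..b, ∑ i, m i * asymAbs s (x t i)) ≤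
      S.storage P u s h d x k a + γ * ∫ t in a..b, ∑ j, asymAbs s (d t j) := by
  refine hx.functional_le cert.dwell hh hs ha hab hb (fun i => (cert.weight_ac k i).mono ?_) ?_ hd
    (Q' := P' k)
  · rw [uIcc_of_le hab, uIcc_of_le (cert.dwell.tk_lt k).le]
    exact Icc_subset_Icc ha hb
  · filter_upwards [cert.flow k] with t h1 h2
    exact h1 (Ioo_subset_Ioo ha hb h2)

theorem storage_jump_le (cert : DissipationCertificate S T c C α ε γ u m P P')
    (hx : S.IsSolution h d x) (hs : 0 ≤ s) (k : ℕ) :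
    S.storage P u s h d x (k + 1) (S.tk (k + 1)) + ε * ∑ i, asymAbs s (x (S.tk (k + 1)) i) ≤
      S.storage P u s h d x k (S.tk (k + 1)) := by
  have hmem := right_mem_Ioc.2 (cert.dwell.tk_lt k)
  have hmem' := left_mem_Icc.2 (cert.dwell.tk_lt (k + 1)).le
  rw [DelaySystem.storage, DelaySystem.storage, DelaySystem.flowState_tk, ← hx.eq_flowState hmem]
  set v := x (S.tk (k + 1))
  set p := P (k + 1) (S.tk (k + 1))
  suffices ∑ i, p i * asymAbs s ((S.J (k + 1) *ᵥ v) i) + ε * ∑ i, asymAbs s (v i) ≤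
      ∑ i, P k (S.tk (k + 1)) i * asymAbs s (v i) by linarith
  calc ∑ i, p i * asymAbs s ((S.J (k + 1) *ᵥ v) i) + ε * ∑ i, asymAbs s (v i)
      ≤ ∑ i, p i * ∑ j, S.J (k + 1) i j * asymAbs s (v j) + ε * ∑ i, asymAbs s (v i) := by
        refine add_le_add_left (Finset.sum_le_sum fun i _ => mul_le_mul_of_nonneg_left ?_ ?_) _
        · exact asymAbs_sum_mul_le _ (fun j _ => cert.jump_nonneg k i j) _
        · exact cert.c_pos.le.trans (cert.weight_ge _ _ hmem' i)
    _ = ∑ j, (∑ i, p i * S.J (k + 1) i j + ε) * asymAbs s (v j) := by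
        simp only [add_mul, Finset.sum_add_distrib, Finset.mul_sum, Finset.sum_mul, mul_assoc]
        rw [Finset.sum_comm]
    _ ≤ _ := Finset.sum_le_sum fun j _ =>
        mul_le_mul_of_nonneg_right (cert.jump k j) (asymAbs_nonneg hs _)

theorem storage_succ_le (cert : DissipationCertificate S T c C α ε γ u m P P')
    (hx : S.IsSolution h d x) (hs : 0 ≤ s) (k : ℕ) :
    S.storage P u s h d x (k + 1) (S.tk (k + 1)) ≤ S.storage P u s h d x k (S.tk (k + 1)) :=
  (le_add_of_nonneg_right (mul_nonneg cert.ε_pos.le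
    (Finset.sum_nonneg fun _ _ => asymAbs_nonneg hs _))).trans (cert.storage_jump_le hx hs k)

theorem storage_add_integral_le (cert : DissipationCertificate S T c C α ε γ u m P P')
    (hx : S.IsSolution h d x) (hh : 0 ≤ h) (hs : 0 ≤ s)
    (hd : ∀ j b, 0 ≤ b → IntervalIntegrable (fun t => asymAbs s (d t j)) volume 0 b) (k : ℕ) :
    ∀ t ∈ Icc (S.tk k) (S.tk (k + 1)),
      S.storage P u s h d x k t + (∫ t in (0 : ℝ)..t, ∑ i, m i * asymAbs s (x t i)) ≤
        S.storage P u s h d x 0 0 + γ * ∫ t in (0 : ℝ)..t, ∑ j, asymAbs s (d t j) := by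
  have hstep : ∀ k, ∀ t ∈ Icc (S.tk k) (S.tk (k + 1)),
      S.storage P u s h d x k (S.tk k) +
          (∫ t in (0 : ℝ)..(S.tk k), ∑ i, m i * asymAbs s (x t i)) ≤
        S.storage P u s h d x 0 0 + γ * ∫ t in (0 : ℝ)..(S.tk k), ∑ j, asymAbs s (d t j) →
      S.storage P u s h d x k t + (∫ t in (0 : ℝ)..t, ∑ i, m i * asymAbs s (x t i)) ≤
        S.storage P u s h d x 0 0 + γ * ∫ t in (0 : ℝ)..t, ∑ j, asymAbs s (d t j) := by
    intro k t ht h1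
    have h0 := cert.dwell.tk_nonneg k
    have hd' : ∀ j, IntervalIntegrable (fun t => asymAbs s (d t j)) volume (S.tk k) t := fun j =>
      (hd j _ h0).symm.trans (hd j t (h0.trans ht.1))
    have hds : ∀ {a b}, (∀ j, IntervalIntegrable (fun t => asymAbs s (d t j)) volume a b) →
        IntervalIntegrable (fun t => ∑ j, asymAbs s (d t j)) volume a b := fun H => by
      simpa only [Finset.sum_fn] using
        IntervalIntegrable.sum Finset.univ (f := fun j t => asymAbs s (d t j)) fun j _ => H j
    have hm : ∀ {a b}, 0 ≤ a → 0 ≤ b →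
        IntervalIntegrable (fun t => ∑ i, m i * asymAbs s (x t i)) volume a b := fun ha hb =>
      hx.intervalIntegrable_comp cert.dwell hh
        (DelaySystem.IsSolution.continuous_sum_asymAbs s m) (by linarith) (by linarith)
    have h2 := cert.storage_flow_le hx hh hs le_rfl ht.1 ht.2 hd'
    have h3 := intervalIntegral.integral_add_adjacent_intervals
      (hm le_rfl h0) (hm h0 (h0.trans ht.1))
    have h4 := intervalIntegral.integral_add_adjacent_intervals
      (hds fun j => hd j _ h0) (hds hd')
    rw [← h3, ← h4, mul_add]
    linarith
  induction k with
  | zero =>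
    refine fun t ht => hstep 0 t ht ?_
    rw [cert.dwell.tk_zero]
    simp
  | succ k ih =>
    refine fun t ht => hstep (k + 1) t ht ?_
    have h1 := ih (S.tk (k + 1)) (right_mem_Icc.2 (cert.dwell.tk_lt k).le)
    linarith [cert.storage_succ_le hx hs k]

theorem flowState_zero (cert : DissipationCertificate S T c C α ε γ u m P P') :
    S.flowState h d x 0 0 = x 0 := by
  have := S.flowState_tk h d x 0
  rwa [cert.dwell.tk_zero, cert.jump_zero] at this

theorem sum_add_integral_le (cert : DissipationCertificate S T c C α ε γ u m P P')
    (hx : S.IsSolution h d x) (hh : 0 ≤ h) (hs : 0 ≤ s)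
    (hd : ∀ j b, 0 ≤ b → IntervalIntegrable (fun t => asymAbs s (d t j)) volume 0 b) {t : ℝ}
    (ht : 0 ≤ t) :
    c * ∑ i, asymAbs s (x t i) + (∫ t in (0 : ℝ)..t, ∑ i, m i * asymAbs s (x t i)) ≤
      S.storage P u s h d x 0 0 + γ * ∫ t in (0 : ℝ)..t, ∑ j, asymAbs s (d t j) := by
  rcases ht.eq_or_lt with rfl | ht
  · have h0 : (0 : ℝ) ∈ Icc (S.tk 0) (S.tk (0 + 1)) :=
      ⟨cert.dwell.tk_zero.le, cert.dwell.tk_nonneg 1⟩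
    have h1 := cert.sum_le_storage (d := d) (x := x) hh hs h0
    rw [cert.flowState_zero] at h1
    simpa using h1
  · obtain ⟨k, hk⟩ := cert.dwell.exists_mem_Ioc ht
    have h1 := cert.sum_le_storage (d := d) (x := x) hh hs (Ioc_subset_Icc_self hk)
    rw [← hx.eq_flowState hk] at h1
    have h2 := cert.storage_add_integral_le hx hh hs hd k t (Ioc_subset_Icc_self hk)
    linarith

/-- Solutions with nonnegative initial function and input are nonnegative. -/
theorem nonneg (cert : DissipationCertificate S T c C α ε γ u m P P')
    (hx : S.IsSolution h d x) (hh : 0 ≤ h) (hd : ∀ t ≥ 0, 0 ≤ d t)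
    (hx0 : ∀ t ∈ Icc (-h) 0, 0 ≤ x t) {t : ℝ} (ht : 0 ≤ t) : 0 ≤ x t := by
  have hd0 : ∀ j, ∀ t ≥ 0, asymAbs 0 (d t j) = 0 := fun j t ht =>
    asymAbs_zero_left_eq_zero (hd t ht j)
  have h1 := cert.sum_add_integral_le (s := 0) hx hh le_rfl (fun j b hb => by
    refine (intervalIntegrable_const (c := (0 : ℝ))).congr fun t ht => ?_
    rw [uIoc_of_le hb] at ht
    exact (hd0 j t ht.1.le).symm) ht
  have h2 := cert.integral_output_nonneg (x := x) (s := 0) le_rfl ht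
  have h3 : ∫ t in (0 : ℝ)..t, ∑ j, asymAbs 0 (d t j) = 0 := by
    refine intervalIntegral.integral_zero_ae (ae_of_all _ fun τ hτ => ?_)
    rw [uIoc_of_le ht] at hτ
    exact Finset.sum_eq_zero fun j _ => hd0 j τ hτ.1.le
  have hx1 : ∀ t ∈ Icc (-h) 0, ∀ i, asymAbs 0 (x t i) = 0 := fun t ht i =>
    asymAbs_zero_left_eq_zero (hx0 t ht i)
  have h4 : S.storage P u 0 h d x 0 0 = 0 := by
    rw [DelaySystem.storage, cert.flowState_zero,
      Finset.sum_eq_zero fun i _ => by rw [hx1 0 ⟨by linarith, le_rfl⟩ i, mul_zero], zero_add]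
    refine intervalIntegral.integral_zero_ae (ae_of_all _ fun τ hτ => ?_)
    rw [uIoc_of_le (by linarith), zero_sub] at hτ
    exact Finset.sum_eq_zero fun i _ => by rw [hx1 τ (Ioc_subset_Icc_self hτ) i, mul_zero]
  rw [h3, h4, mul_zero, add_zero] at h1
  have h5 : ∑ i, asymAbs 0 (x t i) ≤ 0 :=
    nonpos_of_mul_nonpos_right (by linarith) cert.c_pos
  intro i
  exact nonneg_of_asymAbs_nonpos ((Finset.single_le_sum (f := fun i => asymAbs 0 (x t i))
    (fun i _ => asymAbs_nonneg le_rfl _) (Finset.mem_univ i)).trans h5)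

theorem storage_zero_le (cert : DissipationCertificate S T c C α ε γ u m P P')
    (hx : S.IsSolution h d x) (hh : 0 ≤ h) :
    S.storage P u 1 h d x 0 0 ≤ (Fintype.card ι * C + h * ∑ i, u i) * histNorm h x := by
  rw [DelaySystem.storage, cert.flowState_zero, zero_sub, add_mul]
  have h0 : (0 : ℝ) ∈ Icc (S.tk 0) (S.tk (0 + 1)) :=
    ⟨cert.dwell.tk_zero.le, cert.dwell.tk_nonneg 1⟩
  have hb : ∀ t ∈ Icc (-h) 0, ∀ i, asymAbs 1 (x t i) ≤ histNorm h x := fun t ht i => by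
    rw [asymAbs_one]
    exact (norm_le_pi_norm (x t) i).trans (norm_le_histNorm hx.1 ht)
  refine add_le_add ?_ ?_
  · calc ∑ i, P 0 0 i * asymAbs 1 (x 0 i) ≤ ∑ _i : ι, C * histNorm h x :=
          Finset.sum_le_sum fun i _ => mul_le_mul (cert.weight_le 0 0 h0 i)
            (hb 0 ⟨by linarith, le_rfl⟩ i) (asymAbs_nonneg zero_le_one _) cert.C_nonneg
      _ = _ := by simp [mul_assoc]
  · have h1 : ∫ τ in (-h)..0, ∑ i, u i * asymAbs 1 (x τ i) ≤
        ∫ _τ in (-h)..0, ∑ i, u i * histNorm h x := by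
      refine intervalIntegral.integral_mono_on (by linarith) ?_ intervalIntegrable_const
        fun τ hτ => Finset.sum_le_sum fun i _ =>
          mul_le_mul_of_nonneg_left (hb τ hτ i) (cert.u_nonneg i)
      exact hx.intervalIntegrable_comp cert.dwell hh
        (DelaySystem.IsSolution.continuous_sum_asymAbs 1 u) le_rfl (by linarith)
    refine h1.trans_eq ?_
    rw [intervalIntegral.integral_const, ← Finset.sum_mul]
    simp [mul_assoc]

theorem norm_le (cert : DissipationCertificate S T c C α ε γ u m P P')
    (hx : S.IsSolution h 0 x) (hh : 0 ≤ h) {t : ℝ} (ht : 0 ≤ t) :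
    c * ‖x t‖ ≤ (Fintype.card ι * C + h * ∑ i, u i) * histNorm h x := by
  have h1 := cert.sum_add_integral_le (s := 1) hx hh zero_le_one
    (fun j b _ => by simp [asymAbs_zero]) ht
  have h2 := cert.integral_output_nonneg (x := x) (s := 1) zero_le_one ht
  simp only [Pi.zero_apply, asymAbs_zero, Finset.sum_const_zero, intervalIntegral.integral_zero,
    mul_zero, add_zero] at h1
  simp only [asymAbs_one] at h1 h2
  have h3 := mul_le_mul_of_nonneg_left (norm_le_sum_abs (x t)) cert.c_pos.le
  linarith [cert.storage_zero_le hx hh]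

theorem gain_bound (cert : DissipationCertificate S T c C α ε γ u m P P')
    (hx : S.IsSolution h d x) (hh : 0 ≤ h) (hγ : 0 ≤ γ) (hd : IntegrableOn d (Ioi 0)) :
    IntegrableOn (fun t => S.M *ᵥ x t) (Ioi 0) ∧
      ∫ t in Ioi (0 : ℝ), ∑ i, |(S.M *ᵥ x t) i| ≤
        γ * (∫ t in Ioi (0 : ℝ), ∑ j, |d t j|) +
          (Fintype.card ι * C + h * ∑ i, u i) * histNorm h x := by
  set B := γ * (∫ t in Ioi (0 : ℝ), ∑ j, |d t j|) +
    (Fintype.card ι * C + h * ∑ i, u i) * histNorm h x with hB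
  have hdj : ∀ j, IntegrableOn (fun t => |d t j|) (Ioi 0) := fun j => (hd.eval j).abs
  have hdsum : IntegrableOn (fun t => ∑ j, |d t j|) (Ioi 0) :=
    integrable_finsetSum _ fun j _ => hdj j
  have hMx : ∀ t, ∑ i, |(S.M *ᵥ x t) i| ≤ ∑ i, m i * |x t i| := fun t => by
    calc ∑ i, |(S.M *ᵥ x t) i| ≤ ∑ i, ∑ j, |S.M i j| * |x t j| :=
          Finset.sum_le_sum fun i _ => (Finset.abs_sum_le_sum_abs _ _).trans_eq
            (Finset.sum_congr rfl fun j _ => abs_mul _ _)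
      _ = ∑ j, (∑ i, |S.M i j|) * |x t j| := by
          rw [Finset.sum_comm]; simp only [Finset.sum_mul]
      _ ≤ _ := Finset.sum_le_sum fun j _ =>
          mul_le_mul_of_nonneg_right (cert.output j) (abs_nonneg _)
  have hcomp : ∀ {ψ : (ι → ℝ) → ℝ}, Continuous ψ → ∀ {b}, 0 ≤ b →
      IntervalIntegrable (fun t => ψ (x t)) volume 0 b := fun hψ _ hb =>
    hx.intervalIntegrable_comp cert.dwell hh hψ (by linarith) (by linarith)
  have hMi : ∀ {b : ℝ}, 0 ≤ b →
      IntervalIntegrable (fun t => ∑ i, |(S.M *ᵥ x t) i|) volume 0 b := fun hb =>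
    hcomp (ψ := fun v => ∑ i, |(S.M *ᵥ v) i|) (by
      simp only [Matrix.mulVec, dotProduct]; fun_prop) hb
  have hmi : ∀ {b : ℝ}, 0 ≤ b →
      IntervalIntegrable (fun t => ∑ i, m i * |x t i|) volume 0 b := fun hb =>
    hcomp (ψ := fun v => ∑ i, m i * |v i|) (by fun_prop) hb
  have hbound : ∀ b : ℝ, 0 ≤ b → ∫ t in (0 : ℝ)..b, ∑ i, |(S.M *ᵥ x t) i| ≤ B := by
    intro b hb
    have h1 := cert.sum_add_integral_le (s := 1) hx hh zero_le_one (fun j b hb => by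
      simp only [asymAbs_one]
      exact (intervalIntegrable_iff_integrableOn_Ioc_of_le hb).2
        ((hdj j).mono_set Ioc_subset_Ioi_self)) hb
    have h2 : 0 ≤ c * ∑ i, asymAbs 1 (x b i) :=
      mul_nonneg cert.c_pos.le (Finset.sum_nonneg fun i _ => asymAbs_nonneg zero_le_one _)
    simp only [asymAbs_one] at h1 h2
    have h3 := cert.storage_zero_le hx hh
    have h4 : ∫ t in (0 : ℝ)..b, ∑ j, |d t j| ≤ ∫ t in Ioi (0 : ℝ), ∑ j, |d t j| := by
      rw [intervalIntegral.integral_of_le hb]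
      exact setIntegral_mono_set hdsum
        (ae_of_all _ fun t => Finset.sum_nonneg fun j _ => abs_nonneg _)
        (LE.le.eventuallyLE Ioc_subset_Ioi_self)
    have h5 := intervalIntegral.integral_mono_on hb (hMi hb) (hmi hb) fun t _ => hMx t
    have h6 := mul_le_mul_of_nonneg_left h4 hγ
    linarith
  have hmeas : ∀ n : ℕ, IntegrableOn (fun t => S.M *ᵥ x t) (Ioc 0 (n : ℝ)) := fun n =>
    Integrable.of_eval fun i =>
      (hcomp (ψ := fun v => (S.M *ᵥ v) i) (by
        simp only [Matrix.mulVec, dotProduct]; fun_prop) n.cast_nonneg).1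
  have hMint : IntegrableOn (fun t => S.M *ᵥ x t) (Ioi 0) := by
    refine integrableOn_Ioi_of_intervalIntegral_norm_bounded B 0 hmeas
      tendsto_natCast_atTop_atTop (Eventually.of_forall fun n => ?_)
    refine (intervalIntegral.integral_mono_on n.cast_nonneg ?_ (hMi n.cast_nonneg)
      fun t _ => norm_le_sum_abs _).trans (hbound n n.cast_nonneg)
    exact ((intervalIntegrable_iff_integrableOn_Ioc_of_le n.cast_nonneg).2 (hmeas n)).norm
  refine ⟨hMint, ?_⟩
  have hsum : IntegrableOn (fun t => ∑ i, |(S.M *ᵥ x t) i|) (Ioi 0) :=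
    integrable_finsetSum _ fun i _ => (hMint.eval i).abs
  refine le_of_tendsto (intervalIntegral_tendsto_integral_Ioi 0 hsum tendsto_id) ?_
  filter_upwards [eventually_ge_atTop 0] with b hb using hbound b hb

end DissipationCertificate

namespace DissipationCertificate

variable {ι κ : Type*} [Fintype ι] [Fintype κ] {S : DelaySystem ι κ} {T c C α ε γ h : ℝ}
  {u m : ι → ℝ} {P P' : ℕ → ℝ → ι → ℝ} {x : ℝ → ι → ℝ}

theorem storage_flow_anti (cert : DissipationCertificate S T c C α ε γ u m P P')
    (hx : S.IsSolution h 0 x) (hh : 0 ≤ h) {k : ℕ} {a b : ℝ} (ha : S.tk k ≤ a)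
    (hab : a ≤ b) (hb : b ≤ S.tk (k + 1)) :
    S.storage P u 1 h 0 x k b ≤ S.storage P u 1 h 0 x k a := by
  have h1 := cert.storage_flow_le hx hh zero_le_one ha hab hb fun j => by simp [asymAbs_zero]
  have h2 : 0 ≤ ∫ t in a..b, ∑ i, m i * asymAbs 1 (x t i) :=
    intervalIntegral.integral_nonneg hab fun _ _ =>
      Finset.sum_nonneg fun i _ => mul_nonneg (cert.m_nonneg i) (asymAbs_nonneg zero_le_one _)
  simp only [Pi.zero_apply, asymAbs_zero, Finset.sum_const_zero, intervalIntegral.integral_zero,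
    mul_zero, add_zero] at h1
  linarith

/-- Between impulses, a component can decay faster than exponentially only at the expense of the
storage functional. -/
theorem exp_mul_abs_le (cert : DissipationCertificate S T c C α ε γ u m P P')
    (hx : S.IsSolution h 0 x) (hh : 0 ≤ h) {k : ℕ} {a b : ℝ} (ha : S.tk k ≤ a)
    (hab : a ≤ b) (hb : b ≤ S.tk (k + 1)) (l : ι) :
    c * Real.exp (α / c * (a - b)) * |S.flowState h 0 x k a l| ≤
      c * |S.flowState h 0 x k b l| +
        (S.storage P u 1 h 0 x k a - S.storage P u 1 h 0 x k b) := by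
  classical
  set θ : ℝ → ℝ := fun t => c * Real.exp (α / c * (t - b)) with hθ
  have hθ' : ∀ t, HasDerivAt θ (α / c * θ t) t := fun t => by
    have h1 := ((((hasDerivAt_id t).sub_const b).const_mul (α / c)).exp).const_mul c
    refine h1.congr_deriv ?_
    change c * (Real.exp (α / c * (t - b)) * (α / c * 1)) =
      α / c * (c * Real.exp (α / c * (t - b)))
    ring
  have hθac : AbsolutelyContinuousOnInterval θ a b :=
    ContDiffOn.absolutelyContinuousOnInterval (by
      simp only [hθ]
      exact ContDiff.contDiffOn (by fun_prop))
  have hsingle : ∀ t i, (Pi.single l (θ t) : ι → ℝ) i = if i = l then θ t else 0 := fun t i =>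
    Pi.single_apply ..
  have h1 := hx.functional_le (s := 1) (Q := fun t => P k t - Pi.single l (θ t))
    (Q' := fun t => P' k t - Pi.single l (α / c * θ t)) (u := u) (m := m) (γ := γ)
    cert.dwell hh zero_le_one ha hab hb ?_ ?_ (fun j => by simp [asymAbs_zero])
  · have h2 : 0 ≤ ∫ t in a..b, ∑ i, m i * asymAbs 1 (x t i) :=
      intervalIntegral.integral_nonneg hab fun _ _ =>
        Finset.sum_nonneg fun i _ => mul_nonneg (cert.m_nonneg i) (asymAbs_nonneg zero_le_one _)
    have h3 : θ b = c := by simp [hθ]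
    simp only [Pi.zero_apply, asymAbs_zero, Finset.sum_const_zero, intervalIntegral.integral_zero,
      mul_zero, add_zero, Pi.sub_apply, sub_mul, Finset.sum_sub_distrib, hsingle, ite_mul, zero_mul,
      Finset.sum_ite_eq', Finset.mem_univ, if_true] at h1
    rw [h3, show θ a = c * Real.exp (α / c * (a - b)) from rfl] at h1
    simp only [DelaySystem.storage]
    simp only [asymAbs_one] at h1 h2 ⊢
    linarith
  · intro i
    have h2 : AbsolutelyContinuousOnInterval (fun t => P k t i) a b := (cert.weight_ac k i).mono (by
      rw [uIcc_of_le hab, uIcc_of_le (cert.dwell.tk_lt k).le]; exact Icc_subset_Icc ha hb)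
    rcases eq_or_ne i l with rfl | hi
    · simpa using h2.fun_sub hθac
    · simpa [hi] using h2
  · filter_upwards [cert.flow k] with t h2 ht
    have ht' := Ioo_subset_Ioo ha hb ht
    obtain ⟨h2, h3⟩ := h2 ht'
    refine ⟨fun i => ?_, h3.perturb cert.c_pos l (cert.weight_ge k t (Ioo_subset_Icc_self ht') l)
      cert.α_nonneg (cert.diag_ge k t ht' l) (mul_nonneg cert.c_pos.le (Real.exp_pos _).le) ?_⟩
    · rcases eq_or_ne i l with rfl | hi
      · simpa using (h2 i).fun_sub (hθ' t)
      · simpa [hi] using h2 i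
    · refine mul_le_of_le_one_right cert.c_pos.le (Real.exp_le_one_iff.2 ?_)
      exact mul_nonpos_of_nonneg_of_nonpos (div_nonneg cert.α_nonneg cert.c_pos.le)
        (by linarith [ht.2])

theorem abs_le_storage_sub (cert : DissipationCertificate S T c C α ε γ u m P P')
    (hx : S.IsSolution h 0 x) (hh : 0 ≤ h) {k : ℕ} {t : ℝ} (ht : t ∈ Ioc (S.tk k) (S.tk (k + 1)))
    (hth : S.tk (k + 1) - h ≤ t) (l : ι) :
    |x t l| ≤ Real.exp (α / c * h) * (1 / ε + 1 / c) *
      (S.storage P u 1 h 0 x k (S.tk k) -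
        S.storage P u 1 h 0 x (k + 1) (S.tk (k + 1))) := by
  have hmem := right_mem_Ioc.2 (cert.dwell.tk_lt k)
  have h1 := cert.exp_mul_abs_le hx hh ht.1.le ht.2 le_rfl l
  have h2 := cert.storage_jump_le hx zero_le_one k
  have h3 := cert.storage_flow_anti hx hh le_rfl ht.1.le ht.2
  have h4 := cert.storage_flow_anti hx hh ht.1.le ht.2 le_rfl
  have h5 := cert.storage_succ_le hx zero_le_one k
  rw [← hx.eq_flowState hmem, ← hx.eq_flowState ht] at h1
  simp only [asymAbs_one] at h2
  have h6 : |x (S.tk (k + 1)) l| ≤ ∑ i, |x (S.tk (k + 1)) i| :=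
    Finset.single_le_sum (f := fun i => |x (S.tk (k + 1)) i|) (fun i _ => abs_nonneg _)
      (Finset.mem_univ l)
  set W := S.storage P u 1 h 0 x k (S.tk k)
  set Wt := S.storage P u 1 h 0 x k t
  set Wb := S.storage P u 1 h 0 x k (S.tk (k + 1))
  set W1 := S.storage P u 1 h 0 x (k + 1) (S.tk (k + 1))
  have hc := cert.c_pos
  have hε := cert.ε_pos
  have h7 : |x (S.tk (k + 1)) l| ≤ 1 / ε * (W - W1) := by
    rw [one_div, ← div_eq_inv_mul, le_div_iff₀ hε]
    have := mul_le_mul_of_nonneg_left h6 hε.le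
    linarith
  have h8 : Real.exp (α / c * (t - S.tk (k + 1))) * |x t l| ≤ (1 / ε + 1 / c) * (W - W1) := by
    have h9 : Real.exp (α / c * (t - S.tk (k + 1))) * |x t l| ≤
        |x (S.tk (k + 1)) l| + 1 / c * (Wt - Wb) := by
      rw [one_div, ← div_eq_inv_mul, ← sub_le_iff_le_add', le_div_iff₀ hc]
      linarith
    have h10 : 1 / c * (Wt - Wb) ≤ 1 / c * (W - W1) :=
      mul_le_mul_of_nonneg_left (by linarith) (by positivity)
    linarith
  have h11 : Real.exp (α / c * (t - S.tk (k + 1))) ≥ Real.exp (-(α / c * h)) := by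
    refine Real.exp_le_exp.2 ?_
    have := mul_le_mul_of_nonneg_left (show -h ≤ t - S.tk (k + 1) by linarith)
      (div_nonneg cert.α_nonneg hc.le)
    linarith
  have h12 := (mul_le_mul_of_nonneg_right h11 (abs_nonneg (x t l))).trans h8
  rw [Real.exp_neg, inv_mul_le_iff₀ (Real.exp_pos _)] at h12
  linarith

/-- Solutions with zero input converge to `0`. -/
theorem tendsto_zero (cert : DissipationCertificate S T c C α ε γ u m P P')
    (hx : S.IsSolution h 0 x) (hh : 0 ≤ h) : Tendsto x atTop (𝓝 0) := by
  set W : ℕ → ℝ := fun k => S.storage P u 1 h 0 x k (S.tk k) with hW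
  have hanti : Antitone W := antitone_nat_of_succ_le fun k =>
    (cert.storage_succ_le hx zero_le_one k).trans
      (cert.storage_flow_anti hx hh le_rfl (cert.dwell.tk_lt k).le le_rfl)
  have hW0 : ∀ k, 0 ≤ W k := fun k =>
    cert.storage_nonneg hh zero_le_one (left_mem_Icc.2 (cert.dwell.tk_lt k).le)
  have hbdd : BddBelow (range W) := ⟨0, by rintro _ ⟨k, rfl⟩; exact hW0 k⟩
  have hlim := tendsto_atTop_ciInf hanti hbdd
  set L := ⨅ k, W k
  have hLW : ∀ k, L ≤ W k := fun k => ciInf_le hbdd k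
  have hL0 : 0 ≤ L := le_ciInf hW0
  set K := Real.exp (α / c * h) * (1 / ε + 1 / c) with hK
  have hc := cert.c_pos
  have hε := cert.ε_pos
  have hK0 : 0 < K := by positivity
  set K' := Fintype.card ι * C * K + h * ((∑ i, u i) * K) with hK'
  have hK'0 : 0 ≤ K' := by
    have := cert.C_nonneg
    have := Finset.sum_nonneg fun i (_ : i ∈ Finset.univ) => cert.u_nonneg i
    positivity
  have hLδ : ∀ δ > 0, L ≤ K' * δ := by
    intro δ hδ
    obtain ⟨k₀, hk₀⟩ := (hlim.eventually (gt_mem_nhds (show L < L + δ by linarith))).exists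
    obtain ⟨k, hk⟩ := (((tendsto_add_atTop_iff_nat 1).2
      cert.dwell.tendsto_tk).eventually_gt_atTop (S.tk k₀ + h)).exists
    have hsmall : ∀ t, S.tk (k + 1) - h ≤ t → t ≤ S.tk (k + 1) → ∀ i, |x t i| ≤ K * δ := by
      intro t ht1 ht2 i
      have ht0 : S.tk k₀ < t := by linarith
      obtain ⟨j, hj⟩ := cert.dwell.exists_mem_Ioc ((cert.dwell.tk_nonneg k₀).trans_lt ht0)
      have hkj := cert.dwell.le_of_mem_Ioc hj ht0
      have hjk : S.tk (j + 1) ≤ S.tk (k + 1) :=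
        cert.dwell.strictMono.monotone (cert.dwell.lt_of_mem_Ioc hj ht2)
      refine (cert.abs_le_storage_sub hx hh hj (by linarith) i).trans
        (mul_le_mul_of_nonneg_left ?_ hK0.le)
      have h1 := hanti hkj
      have h2 := hLW (j + 1)
      simp only [hW] at h1 h2 hk₀
      linarith
    refine (hLW (k + 1)).trans ((cert.storage_succ_le hx zero_le_one k).trans ?_)
    have hmem := right_mem_Ioc.2 (cert.dwell.tk_lt k)
    rw [DelaySystem.storage, ← hx.eq_flowState hmem]
    simp only [asymAbs_one]
    have h1 : ∑ i, P k (S.tk (k + 1)) i * |x (S.tk (k + 1)) i| ≤ ∑ _i : ι, C * (K * δ) :=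
      Finset.sum_le_sum fun i _ => mul_le_mul (cert.weight_le _ _ (Ioc_subset_Icc_self hmem) i)
        (hsmall _ (by linarith) le_rfl i) (abs_nonneg _) cert.C_nonneg
    have h2 : ∫ τ in (S.tk (k + 1) - h)..(S.tk (k + 1)), ∑ i, u i * |x τ i| ≤
        ∫ _τ in (S.tk (k + 1) - h)..(S.tk (k + 1)), ∑ i, u i * (K * δ) := by
      refine intervalIntegral.integral_mono_on (by linarith) ?_ intervalIntegrable_const
        fun τ hτ => Finset.sum_le_sum fun i _ =>
          mul_le_mul_of_nonneg_left (hsmall τ hτ.1 hτ.2 i) (cert.u_nonneg i)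
      have := cert.dwell.tk_nonneg (k + 1)
      exact hx.intervalIntegrable_comp cert.dwell hh (ψ := fun v => ∑ i, u i * |v i|)
        (by fun_prop) (by linarith) (by linarith)
    rw [intervalIntegral.integral_const, ← Finset.sum_mul] at h2
    rw [Finset.sum_const, Finset.card_univ, nsmul_eq_mul] at h1
    simp only [sub_sub_cancel, smul_eq_mul] at h2
    rw [hK']
    linarith
  have hL : L = 0 := by
    refine le_antisymm (le_of_forall_pos_le_add fun δ hδ => ?_) hL0
    have h1 := hLδ (δ / (K' + 1)) (by positivity)
    have h2 : K' * (δ / (K' + 1)) ≤ δ := by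
      rw [mul_div_assoc', div_le_iff₀ (by positivity)]
      nlinarith
    linarith
  rw [hL] at hlim
  rw [Metric.tendsto_atTop]
  intro δ hδ
  obtain ⟨k, hk⟩ := (hlim.eventually (gt_mem_nhds (mul_pos hc hδ))).exists
  refine ⟨S.tk k + 1, fun t ht => ?_⟩
  have ht0 : S.tk k < t := by linarith
  obtain ⟨j, hj⟩ := cert.dwell.exists_mem_Ioc ((cert.dwell.tk_nonneg k).trans_lt ht0)
  have h1 := cert.sum_le_storage (x := x) (d := 0) hh zero_le_one (Ioc_subset_Icc_self hj)
  have h2 := cert.storage_flow_anti hx hh le_rfl hj.1.le hj.2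
  have h3 := hanti (cert.dwell.le_of_mem_Ioc hj ht0)
  rw [← hx.eq_flowState hj] at h1
  simp only [asymAbs_one] at h1
  have h4 := mul_le_mul_of_nonneg_left (norm_le_sum_abs (x t)) hc.le
  rw [dist_zero_right]
  refine lt_of_mul_lt_mul_left ?_ hc.le
  simp only [hW] at h3 hk
  linarith

end DissipationCertificate

section Family

variable {N : ℕ} {ι κ : Type*} [Fintype ι] [Fintype κ] {T c C α ε γ h : ℝ}
  {S : SwitchingSignal N T → DelaySystem ι κ} {u m : ι → ℝ}

/-- A family with uniform dissipation certificates is asymptotically stable. -/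
theorem AsymptoticallyStable.of_certificate (hc : 0 < c) (hh : 0 ≤ h)
    (cert : ∀ σ, ∃ P P', DissipationCertificate (S σ) T c C α ε γ u m P P') :
    AsymptoticallyStable S h := by
  refine ⟨fun δ hδ => ?_, fun σ x hx => ?_⟩
  · set K := |Fintype.card ι * C + h * ∑ i, u i| with hK
    have hK0 : 0 < K + 1 := by positivity
    refine ⟨c * δ / (K + 1), by positivity, fun σ x hx hx0 t ht => ?_⟩
    obtain ⟨P, P', cert⟩ := cert σ
    have h0 : 0 ≤ histNorm h x :=
      (norm_nonneg _).trans (norm_le_histNorm hx.1 (right_mem_Icc.2 (by linarith)))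
    have h1 := cert.norm_le hx hh ht
    have h2 : (Fintype.card ι * C + h * ∑ i, u i) * histNorm h x ≤ (K + 1) * histNorm h x :=
      mul_le_mul_of_nonneg_right ((le_abs_self _).trans (by linarith)) h0
    rw [lt_div_iff₀ hK0] at hx0
    refine lt_of_mul_lt_mul_left ?_ hc.le
    linarith
  · obtain ⟨P, P', cert⟩ := cert σ
    exact cert.tendsto_zero hx hh

/-- A family with uniform dissipation certificates has `L₁`-gain at most `γ`. -/
theorem HasL1Gain.of_certificate (hγ : 0 ≤ γ) (hh : 0 ≤ h)
    (cert : ∀ σ, ∃ P P', DissipationCertificate (S σ) T c C α ε γ u m P P') :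
    HasL1Gain S h γ := by
  set K := |Fintype.card ι * C + h * ∑ i, u i| with hK
  have hK0 : 0 < K + 1 := by positivity
  refine ⟨fun r => (K + 1) * r, (strictMono_mul_left_of_pos hK0).strictMonoOn _, mul_zero _,
    tendsto_id.const_mul_atTop hK0, fun σ d x hd hx => ?_⟩
  obtain ⟨P, P', cert⟩ := cert σ
  have h0 : 0 ≤ histNorm h x :=
    (norm_nonneg _).trans (norm_le_histNorm hx.1 (right_mem_Icc.2 (by linarith)))
  obtain ⟨h1, h2⟩ := cert.gain_bound hx hh hγ hd
  refine ⟨h1, h2.trans (add_le_add_right ?_ _)⟩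
  exact mul_le_mul_of_nonneg_right ((le_abs_self _).trans (by linarith)) h0

end Family

section Clock

theorem _root_.AbsolutelyContinuousOnInterval.comp_monotone {f φ : ℝ → ℝ} {a b c d : ℝ}
    (hf : AbsolutelyContinuousOnInterval f c d) (hφ : Monotone φ) (hL : LipschitzWith 1 φ)
    (hmaps : MapsTo φ (uIcc a b) (uIcc c d)) :
    AbsolutelyContinuousOnInterval (fun t => f (φ t)) a b := by
  rw [absolutelyContinuousOnInterval_iff] at hf ⊢
  intro ε hε
  obtain ⟨δ, hδ, H⟩ := hf ε hε
  refine ⟨δ, hδ, fun E hE hlt => H (E.1, fun i => (φ (E.2 i).1, φ (E.2 i).2)) ⟨?_, ?_⟩ ?_⟩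
  · exact fun i hi => ⟨hmaps (hE.1 i hi).1, hmaps (hE.1 i hi).2⟩
  · intro i hi j hj hij
    have h1 := hE.2 hi hj hij
    simp only [Function.onFun, uIoc, Ioc_disjoint_Ioc] at h1 ⊢
    simpa only [hφ.map_min, hφ.map_max] using hφ h1
  · refine (Finset.sum_le_sum fun i _ => ?_).trans_lt hlt
    simpa using hL.dist_le_mul (E.2 i).1 (E.2 i).2

/-- A differentiable function with derivative bounded above is absolutely continuous. -/
theorem absolutelyContinuousOnInterval_of_deriv_le {f f' : ℝ → ℝ} {a b α : ℝ} (hab : a ≤ b)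
    (hf : ∀ t ∈ Icc a b, HasDerivWithinAt f (f' t) (Icc a b) t) (hα : ∀ t ∈ Icc a b, f' t ≤ α) :
    AbsolutelyContinuousOnInterval f a b := by
  have hcont : ContinuousOn f (Icc a b) := fun t ht => (hf t ht).continuousWithinAt
  have hderiv : ∀ t ∈ Ioo a b, HasDerivAt f (f' t) t := fun t ht =>
    (hf t (Ioo_subset_Icc_self ht)).hasDerivAt (Icc_mem_nhds ht.1 ht.2)
  have h1 : IntegrableOn (fun t => α - f' t) (Ioc a b) := by
    refine intervalIntegral.integrableOn_deriv_of_nonneg (g := fun t => α * t - f t)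
      ((continuous_const_mul α).continuousOn.sub hcont) (fun t ht => ?_)
      fun t ht => sub_nonneg.2 (hα t (Ioo_subset_Icc_self ht))
    simpa using ((hasDerivAt_id t).const_mul α).fun_sub (hderiv t ht)
  have h2 : IntervalIntegrable f' volume a b := by
    have := (intervalIntegrable_const (c := α)).sub
      ((intervalIntegrable_iff_integrableOn_Ioc_of_le hab).2 h1)
    simpa using this
  refine (h2.absolutelyContinuousOnInterval_const_add (f a)).congr_of_eqOn fun t ht => ?_
  rw [uIcc_of_le hab] at ht
  have h3 := intervalIntegral.integral_eq_sub_of_hasDerivAt_of_le ht.1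
    (hcont.mono (Icc_subset_Icc_right ht.2)) (fun s hs => hderiv s ⟨hs.1, hs.2.trans_le ht.2⟩)
    (h2.mono_set (by
      rw [uIcc_of_le ht.1, uIcc_of_le hab]; exact Icc_subset_Icc_right ht.2))
  simp [h3]

theorem min_sub_mem_Icc {a t T : ℝ} (hT : 0 ≤ T) (ht : a ≤ t) : min (t - a) T ∈ Icc 0 T :=
  ⟨le_min (sub_nonneg.2 ht) hT, min_le_right _ _⟩

theorem lipschitzWith_min_sub (a T : ℝ) : LipschitzWith 1 fun t : ℝ => min (t - a) T :=
  (LipschitzWith.of_dist_le_mul fun _ _ => by simp).min_const T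

theorem monotone_min_sub (a T : ℝ) : Monotone fun t : ℝ => min (t - a) T := fun _ _ hxy =>
  min_le_min_right T (sub_le_sub_right hxy a)

/-- Derivative of `f (min (t - a) T)` away from `a + T`. -/
theorem hasDerivAt_comp_min_sub {f f' : ℝ → ℝ} {T : ℝ}
    (hf : ∀ t ∈ Icc 0 T, HasDerivWithinAt f (f' t) (Icc 0 T) t) {a t : ℝ} (hat : a < t)
    (htT : t ≠ a + T) :
    HasDerivAt (fun t => f (min (t - a) T)) (if t - a < T then f' (t - a) else 0) t := by
  rcases htT.lt_or_gt with h | h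
  · have h1 : HasDerivAt f (f' (t - a)) (t - a) :=
      (hf _ ⟨by linarith, by linarith⟩).hasDerivAt (Icc_mem_nhds (by linarith) (by linarith))
    rw [if_pos (by linarith)]
    refine (h1.comp_sub_const t a).congr_of_eventuallyEq ?_
    filter_upwards [gt_mem_nhds h] with τ hτ
    rw [min_eq_left (by linarith)]
  · rw [if_neg (by linarith)]
    refine (hasDerivAt_const t (f T)).congr_of_eventuallyEq ?_
    filter_upwards [lt_mem_nhds h] with τ hτ
    rw [min_eq_right (by linarith)]

end Clock

section BlockDiagonal

variable {ι κ : Type*} {N : ℕ}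

theorem blockDiagonal_nonneg {A : Fin N → Matrix ι κ ℝ} (hA : ∀ i a b, 0 ≤ A i a b)
    (x : ι × Fin N) (y : κ × Fin N) : 0 ≤ Matrix.blockDiagonal A x y := by
  rw [Matrix.blockDiagonal_apply]
  split_ifs
  exacts [hA _ _ _, le_rfl]

variable [Fintype ι]

theorem sum_mul_blockDiagonal (Q : Fin N → ι → ℝ) (A : Fin N → Matrix ι κ ℝ) (b : κ) (j : Fin N) :
    ∑ x : ι × Fin N, Q x.2 x.1 * Matrix.blockDiagonal A x (b, j) = ∑ a, Q j a * A j a b := by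
  rw [Fintype.sum_prod_type]
  simp [Matrix.blockDiagonal_apply]

theorem FlowBound.blockDiagonal {A G : Fin N → Matrix ι ι ℝ} {E : Fin N → Matrix ι κ ℝ}
    {Q Q' : Fin N → ι → ℝ} {u m : ι → ℝ} {γ : ℝ}
    (h : ∀ i, FlowBound (A i) (G i) (E i) (Q i) (Q' i) u m γ) :
    FlowBound (Matrix.blockDiagonal A) (Matrix.blockDiagonal G) (Matrix.blockDiagonal E)
      (fun x => Q x.2 x.1) (fun x => Q' x.2 x.1) (fun x => u x.1) (fun x => m x.1) γ where
  weight_nonneg x := (h x.2).weight_nonneg x.1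
  metzler x y hxy := by
    rw [Matrix.blockDiagonal_apply]
    split_ifs with h1
    · exact (h x.2).metzler _ _ fun h2 => hxy (Prod.ext h2 h1)
    · exact le_rfl
  delay_nonneg := blockDiagonal_nonneg fun i => (h i).delay_nonneg
  input_nonneg := blockDiagonal_nonneg fun i => (h i).input_nonneg
  state_column y := by
    rw [sum_mul_blockDiagonal]
    exact (h y.2).state_column y.1
  delay_column y := by
    rw [sum_mul_blockDiagonal]
    exact (h y.2).delay_column y.1
  input_column y := by
    rw [sum_mul_blockDiagonal]
    exact (h y.2).input_column y.1

end BlockDiagonal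

theorem FlowBound.deriv_le {ι κ : Type*} [Fintype ι] {A G : Matrix ι ι ℝ} {E : Matrix ι κ ℝ}
    {Q Q' u m : ι → ℝ} {γ α : ℝ} (h : FlowBound A G E Q Q' u m γ) {i : ι}
    (hα : -α ≤ Q i * A i i) (hu : 0 ≤ u i) (hm : 0 ≤ m i) : Q' i ≤ α := by
  classical
  have h1 := h.state_column i
  rw [← Finset.add_sum_erase _ _ (Finset.mem_univ i)] at h1
  have h2 : 0 ≤ ∑ j ∈ Finset.univ.erase i, Q j * A j i := Finset.sum_nonneg fun j hj =>
    mul_nonneg (h.weight_nonneg j) (h.metzler j i (Finset.ne_of_mem_erase hj))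
  linarith

namespace SwitchingSignal

variable {N : ℕ} {T : ℝ}

theorem time_sub_min (σ : SwitchingSignal N T) (k : ℕ) :
    min (σ.time (k + 1) - σ.time k) T = T := min_eq_right (σ.dwell k)

end SwitchingSignal

variable {N n p q : ℕ}

/-- Weights `w i τ`, as a function of the mode and of the time `τ` spent in it (frozen at `τ = T`),
that certify dissipation of the error dynamics for the gains `L`. -/
structure GainCertificate (P : SwitchedPlant N n p q) (L : Fin N → ℝ → Matrix (Fin n) (Fin q) ℝ)
    (M : Matrix (Fin n) (Fin n) ℝ) (T c C α ε γ : ℝ) (u : Fin n → ℝ)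
    (w w' : Fin N → ℝ → Fin n → ℝ) : Prop where
  T_pos : 0 < T
  c_pos : 0 < c
  C_nonneg : 0 ≤ C
  ε_pos : 0 < ε
  α_nonneg : 0 ≤ α
  u_nonneg : ∀ a, 0 ≤ u a
  hasDeriv : ∀ i a, ∀ τ ∈ Icc 0 T,
    HasDerivWithinAt (fun τ => w i τ a) (w' i τ a) (Icc 0 T) τ
  flow : ∀ i, ∀ τ ∈ Icc 0 T, FlowBound (P.A i - L i τ * P.C i) (P.G i - L i τ * P.H i)
    (P.E i - L i τ * P.F i) (w i τ) (w' i τ) u (fun b => ∑ a, |M a b|) γ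
  flow_end : ∀ i, FlowBound (P.A i - L i T * P.C i) (P.G i - L i T * P.H i)
    (P.E i - L i T * P.F i) (w i T) 0 u (fun b => ∑ a, |M a b|) γ
  diag_ge : ∀ i, ∀ τ ∈ Icc 0 T, ∀ a, -α ≤ w i τ a * (P.A i - L i τ * P.C i) a a
  weight_ge : ∀ i, ∀ τ ∈ Icc 0 T, ∀ a, c ≤ w i τ a
  weight_le : ∀ i, ∀ τ ∈ Icc 0 T, ∀ a, w i τ a ≤ C
  jump : ∀ i j, i ≠ j → ∀ a, w i 0 a + ε ≤ w j T a

namespace GainCertificate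

variable {P : SwitchedPlant N n p q} {L : Fin N → ℝ → Matrix (Fin n) (Fin q) ℝ}
  {M : Matrix (Fin n) (Fin n) ℝ} {T c C α ε γ : ℝ} {u : Fin n → ℝ}
  {w w' : Fin N → ℝ → Fin n → ℝ}

theorem clock_ac (cert : GainCertificate P L M T c C α ε γ u w w') (σ : SwitchingSignal N T)
    (i : Fin N) (k : ℕ) (a : Fin n) :
    AbsolutelyContinuousOnInterval (fun t => w i (min (t - σ.time k) T) a)
      (σ.time k) (σ.time (k + 1)) := by
  have h1 : AbsolutelyContinuousOnInterval (fun τ => w i τ a) 0 T :=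
    absolutelyContinuousOnInterval_of_deriv_le cert.T_pos.le (cert.hasDeriv i a) fun τ hτ =>
      (cert.flow i τ hτ).deriv_le (cert.diag_ge i τ hτ a) (cert.u_nonneg a)
        (Finset.sum_nonneg fun _ _ => abs_nonneg _)
  refine h1.comp_monotone (monotone_min_sub (σ.time k) T) (lipschitzWith_min_sub _ _) ?_
  intro t ht
  have hlt : σ.time k ≤ σ.time (k + 1) := by linarith [σ.dwell k, cert.T_pos]
  rw [uIcc_of_le hlt] at ht
  rw [uIcc_of_le cert.T_pos.le]
  exact min_sub_mem_Icc cert.T_pos.le ht.1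

theorem clock_flow (cert : GainCertificate P L M T c C α ε γ u w w') {a t : ℝ} (hat : a < t)
    (htT : t ≠ a + T) (i : Fin N) :
    (∀ b, HasDerivAt (fun t => w i (min (t - a) T) b)
        (if t - a < T then w' i (t - a) b else 0) t) ∧
      FlowBound (P.A i - L i (min (t - a) T) * P.C i) (P.G i - L i (min (t - a) T) * P.H i)
        (P.E i - L i (min (t - a) T) * P.F i) (w i (min (t - a) T))
        (fun b => if t - a < T then w' i (t - a) b else 0) u (fun b => ∑ a, |M a b|) γ := by
  refine ⟨fun b => hasDerivAt_comp_min_sub (cert.hasDeriv i b) hat htT, ?_⟩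
  by_cases h : t - a < T
  · simp only [h, if_true, min_eq_left h.le]
    exact cert.flow i _ ⟨by linarith, h.le⟩
  · simp only [h, if_false, min_eq_right (not_lt.1 h)]
    exact cert.flow_end i

theorem hasDwellTime_errorSystem (hT : 0 < T) (σ : SwitchingSignal N T) :
    (P.errorSystem L M σ).HasDwellTime T := ⟨hT, σ.time_zero, σ.dwell⟩

theorem hasDwellTime_liftedErrorSystem (hT : 0 < T) (σ : SwitchingSignal N T) :
    (P.liftedErrorSystem L M σ).HasDwellTime T := ⟨hT, σ.time_zero, σ.dwell⟩

theorem errorSystem (cert : GainCertificate P L M T c C α ε γ u w w') (σ : SwitchingSignal N T) :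
    DissipationCertificate (P.errorSystem L M σ) T c C α ε γ u (fun b => ∑ a, |M a b|)
      (fun k t => w (σ.mode k) (min (t - σ.time k) T))
      (fun k t b => if t - σ.time k < T then w' (σ.mode k) (t - σ.time k) b else 0) where
  dwell := hasDwellTime_errorSystem cert.T_pos σ
  c_pos := cert.c_pos
  C_nonneg := cert.C_nonneg
  ε_pos := cert.ε_pos
  α_nonneg := cert.α_nonneg
  u_nonneg := cert.u_nonneg
  weight_ac k := cert.clock_ac σ (σ.mode k) k
  flow k := by
    filter_upwards [(countable_singleton (σ.time k + T)).ae_notMem volume] with t h1 ht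
    exact cert.clock_flow ht.1 h1 (σ.mode k)
  diag_ge k t ht a := cert.diag_ge _ _ (min_sub_mem_Icc cert.T_pos.le ht.1.le) a
  weight_ge k t ht a := cert.weight_ge _ _ (min_sub_mem_Icc cert.T_pos.le ht.1) a
  weight_le k t ht a := cert.weight_le _ _ (min_sub_mem_Icc cert.T_pos.le ht.1) a
  jump_zero v := Matrix.one_mulVec v
  jump_nonneg k a b := by
    change 0 ≤ (1 : Matrix (Fin n) (Fin n) ℝ) a b
    rw [Matrix.one_apply]
    split_ifs <;> norm_num
  jump k b := by
    have h1 := cert.jump _ _ (σ.mode_ne k) b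
    simpa [SwitchedPlant.errorSystem, Matrix.one_apply, σ.time_sub_min k, cert.T_pos.le] using h1
  output _ := le_rfl

theorem liftedErrorSystem (cert : GainCertificate P L M T c C α ε γ u w w')
    (σ : SwitchingSignal N T) :
    DissipationCertificate (P.liftedErrorSystem L M σ) T c C α (min ε c) γ (fun x => u x.1)
      (fun y => ∑ a, |M a y.1|) (fun k t x => w x.2 (min (t - σ.time k) T) x.1)
      (fun k t x => if t - σ.time k < T then w' x.2 (t - σ.time k) x.1 else 0) where
  dwell := hasDwellTime_liftedErrorSystem cert.T_pos σ
  c_pos := cert.c_pos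
  C_nonneg := cert.C_nonneg
  ε_pos := lt_min cert.ε_pos cert.c_pos
  α_nonneg := cert.α_nonneg
  u_nonneg x := cert.u_nonneg x.1
  weight_ac k x := cert.clock_ac σ x.2 k x.1
  flow k := by
    filter_upwards [(countable_singleton (σ.time k + T)).ae_notMem volume] with t h1 ht
    have h2 := fun i => cert.clock_flow ht.1 h1 i
    exact ⟨fun x => (h2 x.2).1 x.1, FlowBound.blockDiagonal fun i => (h2 i).2⟩
  diag_ge k t ht x := by
    simp only [SwitchedPlant.liftedErrorSystem, Matrix.blockDiagonal_apply, if_true]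
    exact cert.diag_ge _ _ (min_sub_mem_Icc cert.T_pos.le ht.1.le) x.1
  weight_ge k t ht x := cert.weight_ge _ _ (min_sub_mem_Icc cert.T_pos.le ht.1) x.1
  weight_le k t ht x := cert.weight_le _ _ (min_sub_mem_Icc cert.T_pos.le ht.1) x.1
  jump_zero v := Matrix.one_mulVec v
  jump_nonneg k x y := by
    simp only [SwitchedPlant.liftedErrorSystem, Matrix.kroneckerMap_apply, Matrix.vecMulVec_apply,
      Matrix.one_apply, Pi.single_apply]
    split_ifs <;> norm_num
  jump k y := by
    obtain ⟨b, j⟩ := y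
    simp only [SwitchedPlant.liftedErrorSystem, σ.time_sub_min k, sub_self,
      min_eq_left cert.T_pos.le, Matrix.kroneckerMap_apply, Matrix.vecMulVec_apply,
      Fintype.sum_prod_type, Matrix.one_apply, Pi.single_apply]
    by_cases hj : j = σ.mode k
    · have h1 := cert.jump _ _ (σ.mode_ne k) b
      have h2 := min_le_left ε c
      simp [hj]
      linarith
    · have h1 := cert.weight_ge j T (right_mem_Icc.2 cert.T_pos.le) b
      simp [hj, h1]
  output y := by
    have h1 := sum_mul_blockDiagonal (fun _ _ => 1) (fun _ : Fin N => M.map abs) y.1 y.2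
    simp only [one_mul] at h1
    refine (le_of_eq ?_).trans h1.le
    refine Finset.sum_congr rfl fun x _ => ?_
    simp only [SwitchedPlant.liftedErrorSystem, Matrix.blockDiagonal_apply, Matrix.map_apply]
    split_ifs <;> simp

end GainCertificate

section Enclosure

theorem IsTrajectory.congr_rhs {ι : Type*} [Fintype ι] {tk : ℕ → ℝ} {h : ℝ}
    {J : ℕ → Matrix ι ι ℝ} {f g : ℕ → ℝ → ι → ℝ} {x : ℝ → ι → ℝ} (hx : IsTrajectory tk h J f x)
    (hfg : ∀ k t, f k t = g k t) : IsTrajectory tk h J g x :=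
  (funext₂ hfg : f = g) ▸ hx

theorem IsTrajectory.sub {ι : Type*} [Fintype ι] {tk : ℕ → ℝ} {h : ℝ} {J : ℕ → Matrix ι ι ℝ}
    {f g : ℕ → ℝ → ι → ℝ} {x y : ℝ → ι → ℝ} (hx : IsTrajectory tk h J f x)
    (hy : IsTrajectory tk h J g y) :
    IsTrajectory tk h J (fun k t => f k t - g k t) (fun t => x t - y t) := by
  refine ⟨hx.1.sub hy.1, fun k t ht => ?_⟩
  obtain ⟨h1, h2⟩ := hx.2 k t ht
  obtain ⟨h3, h4⟩ := hy.2 k t ht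
  refine ⟨h1.sub h3, ?_⟩
  beta_reduce
  rw [intervalIntegral.integral_sub h1 h3, Matrix.mulVec_sub, h2, h4]
  abel

variable {P : SwitchedPlant N n p q} {L : Fin N → ℝ → Matrix (Fin n) (Fin q) ℝ} {T h : ℝ}
  {σ : SwitchingSignal N T} {w w' : ℝ → Fin p → ℝ} {x z : ℝ → Fin n → ℝ}

theorem SwitchedPlant.IsObserverState.isSolution_sub (hz : P.IsObserverState L σ h w x w' z)
    (hx : P.IsState σ h w x) (M : Matrix (Fin n) (Fin n) ℝ) :
    (P.errorSystem L M σ).IsSolution h (fun t => w' t - w t) (fun t => z t - x t) := by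
  have h1 := IsTrajectory.sub hz hx
  refine IsTrajectory.congr_rhs h1 fun k t => ?_
  simp only [SwitchedPlant.errorSystem, SwitchedPlant.output, Matrix.sub_mulVec, Matrix.mulVec_sub,
    Matrix.mulVec_add, ← Matrix.mulVec_mulVec]
  abel

theorem SwitchedPlant.IsObserverState.isSolution_rev_sub (hz : P.IsObserverState L σ h w x w' z)
    (hx : P.IsState σ h w x) (M : Matrix (Fin n) (Fin n) ℝ) :
    (P.errorSystem L M σ).IsSolution h (fun t => w t - w' t) (fun t => x t - z t) := by
  have h1 := IsTrajectory.sub hx hz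
  refine IsTrajectory.congr_rhs h1 fun k t => ?_
  simp only [SwitchedPlant.errorSystem, SwitchedPlant.output, Matrix.sub_mulVec, Matrix.mulVec_sub,
    Matrix.mulVec_add, ← Matrix.mulVec_mulVec]
  abel

end Enclosure

theorem GainCertificate.solvesObservationProblem {P : SwitchedPlant N n p q}
    {L : Fin N → ℝ → Matrix (Fin n) (Fin q) ℝ} {M : Matrix (Fin n) (Fin n) ℝ}
    {T c C α ε γ h : ℝ} {u : Fin n → ℝ} {w w' : Fin N → ℝ → Fin n → ℝ}
    (cert : GainCertificate P L M T c C α ε γ u w w') (hh : 0 ≤ h) (hγ : 0 ≤ γ) :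
    P.SolvesObservationProblem T h γ M L where
  metzler i τ hτ := (cert.flow i τ hτ).metzler
  input_nonneg i τ hτ := (cert.flow i τ hτ).input_nonneg
  delay_nonneg i τ hτ := (cert.flow i τ hτ).delay_nonneg
  enclosure σ v v₁ v₂ x x₁ x₂ hx hx₁ hx₂ hv h0 t ht := by
    have h1 := (cert.errorSystem σ).nonneg (hx₁.isSolution_rev_sub hx M) hh
      (fun t ht => sub_nonneg.2 (hv t ht).1) (fun t ht => sub_nonneg.2 (h0 t ht).1) ht
    have h2 := (cert.errorSystem σ).nonneg (hx₂.isSolution_sub hx M) hh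
      (fun t ht => sub_nonneg.2 (hv t ht).2) (fun t ht => sub_nonneg.2 (h0 t ht).2) ht
    exact ⟨sub_nonneg.1 h1, sub_nonneg.1 h2⟩
  stable := .of_certificate cert.c_pos hh fun σ => ⟨_, _, cert.errorSystem σ⟩
  gain := .of_certificate hγ hh fun σ => ⟨_, _, cert.errorSystem σ⟩
  lifted_stable := .of_certificate cert.c_pos hh fun σ => ⟨_, _, cert.liftedErrorSystem σ⟩
  lifted_gain := .of_certificate hγ hh fun σ => ⟨_, _, cert.liftedErrorSystem σ⟩

end SwitchedObserver

namespace SwitchedObserver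

section Matrices

variable {n r : ℕ}

theorem _root_.Matrix.IsDiag.mul_apply {X : Matrix (Fin n) (Fin n) ℝ} (hX : X.IsDiag)
    (B : Matrix (Fin n) (Fin r) ℝ) (a : Fin n) (b : Fin r) : (X * B) a b = X a a * B a b := by
  conv_lhs => rw [← hX.diagonal_diag]
  rw [Matrix.diagonal_mul, Matrix.diag_apply]

theorem _root_.Matrix.IsDiag.sum_column {X : Matrix (Fin n) (Fin n) ℝ} (hX : X.IsDiag)
    (b : Fin n) : ∑ a, X a b = X b b :=
  Finset.sum_eq_single b (fun _ _ h => hX h) fun h => absurd (Finset.mem_univ b) h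

theorem one_vecMul_apply (B : Matrix (Fin n) (Fin r) ℝ) (b : Fin r) :
    ((1 : Fin n → ℝ) ᵥ* B) b = ∑ a, B a b := by
  simp [Matrix.vecMul, dotProduct]

theorem _root_.Matrix.IsDiag.apply_ne_zero {X : Matrix (Fin n) (Fin n) ℝ} (hX : X.IsDiag)
    (hXu : IsUnit X) (a : Fin n) : X a a ≠ 0 := by
  obtain ⟨B, hB⟩ := hXu.exists_right_inv
  have h1 := hX.mul_apply B a a
  rw [hB, Matrix.one_apply_eq] at h1
  exact left_ne_zero_of_mul (h1 ▸ one_ne_zero)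

/-- For diagonal `X`, the entries of the closed-loop matrix `A - X⁻¹ Y C`, weighted by `X`. -/
theorem diag_mul_closedLoop {q : ℕ} {X : Matrix (Fin n) (Fin n) ℝ} (hX : X.IsDiag)
    (hXu : IsUnit X) (Y : Matrix (Fin n) (Fin q) ℝ) (A : Matrix (Fin n) (Fin r) ℝ)
    (C : Matrix (Fin q) (Fin r) ℝ) (a : Fin n) (b : Fin r) :
    X a a * (A - X⁻¹ * Y * C) a b = (X * A - Y * C) a b := by
  rw [← hX.mul_apply, Matrix.mul_sub, Matrix.mul_assoc,
    Matrix.mul_nonsing_inv_cancel_left _ _ ((Matrix.isUnit_iff_isUnit_det X).1 hXu)]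

theorem flowBound_of_columns {p q : ℕ} {A G X D U M : Matrix (Fin n) (Fin n) ℝ}
    {E : Matrix (Fin n) (Fin p) ℝ} {C H : Matrix (Fin q) (Fin n) ℝ} {F : Matrix (Fin q) (Fin p) ℝ}
    {Y : Matrix (Fin n) (Fin q) ℝ} {α γ : ℝ} (hX : X.IsDiag) (hXu : IsUnit X)
    (hpos : ∀ a, 0 < X a a) (hD : D.IsDiag) (hU : U.IsDiag) (hM : ∀ a b, 0 ≤ M a b)
    (hA : ∀ a b, 0 ≤ (X * A - Y * C + α • (1 : Matrix (Fin n) (Fin n) ℝ)) a b)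
    (hG : ∀ a b, 0 ≤ (X * G - Y * H) a b) (hE : ∀ a b, 0 ≤ (X * E - Y * F) a b)
    (hAc : 1 ᵥ* (D + X * A - Y * C + U) + 1 ᵥ* M ≤ 0) (hGc : 1 ᵥ* (X * G - Y * H - U) ≤ 0)
    (hEc : 1 ᵥ* (X * E - Y * F) - γ • (1 : Fin p → ℝ) ≤ 0) :
    FlowBound (A - X⁻¹ * Y * C) (G - X⁻¹ * Y * H) (E - X⁻¹ * Y * F) (fun a => X a a)
      (fun a => D a a) (fun a => U a a) (fun b => ∑ a, |M a b|) γ where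
  weight_nonneg a := (hpos a).le
  metzler a b hab := by
    rw [← mul_nonneg_iff_of_pos_left (hpos a), diag_mul_closedLoop hX hXu]
    simpa [hab] using hA a b
  delay_nonneg a b := by
    rw [← mul_nonneg_iff_of_pos_left (hpos a), diag_mul_closedLoop hX hXu]
    exact hG a b
  input_nonneg a b := by
    rw [← mul_nonneg_iff_of_pos_left (hpos a), diag_mul_closedLoop hX hXu]
    exact hE a b
  state_column b := by
    have h1 := hAc b
    rw [Pi.add_apply, one_vecMul_apply, one_vecMul_apply] at h1
    simp only [Matrix.add_apply, Matrix.sub_apply, Finset.sum_add_distrib, Finset.sum_sub_distrib,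
      hD.sum_column, hU.sum_column, Pi.zero_apply] at h1
    simp only [diag_mul_closedLoop hX hXu]
    simp only [abs_of_nonneg (hM _ _), Matrix.sub_apply,
      Finset.sum_sub_distrib]
    linarith
  delay_column b := by
    have h1 := hGc b
    rw [one_vecMul_apply] at h1
    simp only [Matrix.sub_apply, Finset.sum_sub_distrib, hU.sum_column, Pi.zero_apply] at h1
    simp only [diag_mul_closedLoop hX hXu]
    simp only [Matrix.sub_apply, Finset.sum_sub_distrib]
    linarith
  input_column b := by
    have h1 := hEc b
    rw [Pi.sub_apply, one_vecMul_apply] at h1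
    simp only [Matrix.sub_apply, Finset.sum_sub_distrib, Pi.zero_apply, Pi.smul_apply, Pi.one_apply,
      smul_eq_mul, mul_one] at h1
    simp only [diag_mul_closedLoop hX hXu]
    simp only [Matrix.sub_apply, Finset.sum_sub_distrib]
    linarith

theorem matrixDeriv_isDiag {T : ℝ} {X : ℝ → Matrix (Fin n) (Fin n) ℝ}
    (hX : ∀ τ ∈ Icc 0 T, (X τ).IsDiag) {τ : ℝ} (hτ : τ ∈ Icc 0 T) :
    (matrixDeriv T X τ).IsDiag := by
  intro a b hab
  have h1 : EqOn (fun s => X s a b) (fun _ => 0) (Icc 0 T) := fun s hs => hX s hs hab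
  rw [matrixDeriv, Matrix.of_apply, derivWithin_congr h1 (h1 hτ)]
  simp

end Matrices

/-- A continuous nowhere vanishing function on `[0, T]` that is positive at `0` is positive. -/
theorem pos_of_continuousOn_of_ne_zero {f : ℝ → ℝ} {T : ℝ} (hf : ContinuousOn f (Icc 0 T))
    (h0 : 0 < f 0) (hne : ∀ t ∈ Icc 0 T, f t ≠ 0) {t : ℝ} (ht : t ∈ Icc 0 T) : 0 < f t := by
  by_contra h
  obtain ⟨s, hs, hs0⟩ := intermediate_value_Icc' ht.1 (hf.mono (Icc_subset_Icc_right ht.2))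
    ⟨not_lt.1 h, h0.le⟩
  exact hne s ⟨hs.1, hs.2.trans ht.2⟩ hs0

/-- Finitely many continuous positive functions on `[0, T]` have common positive bounds. -/
theorem exists_bounds_of_continuousOn {ι : Type*} [Finite ι] {T : ℝ} (hT : 0 ≤ T) {f : ι → ℝ → ℝ}
    (hf : ∀ i, ContinuousOn (f i) (Icc 0 T)) (hpos : ∀ i, ∀ t ∈ Icc 0 T, 0 < f i t) :
    ∃ c C : ℝ, 0 < c ∧ 0 ≤ C ∧ ∀ i, ∀ t ∈ Icc 0 T, c ≤ f i t ∧ f i t ≤ C := by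
  have hne : (Icc 0 T).Nonempty := nonempty_Icc.2 hT
  choose s hs hmin using fun i => isCompact_Icc.exists_isMinOn hne (hf i)
  choose r _ hmax using fun i => isCompact_Icc.exists_isMaxOn hne (hf i)
  obtain ⟨c, hc, hc'⟩ := Pi.exists_forall_pos_add_lt (x := fun _ => (0 : ℝ))
    (y := fun i => f i (s i)) fun i => hpos i _ (hs i)
  obtain ⟨C, hC⟩ := (Set.finite_range fun i => f i (r i)).bddAbove
  refine ⟨c, max C 0, hc, le_max_right _ _, fun i t ht => ⟨?_, ?_⟩⟩
  · have := hc' i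
    have := hmin i ht
    simp only [mem_ofPred_eq] at this
    linarith
  · exact (hmax i ht).trans ((hC (mem_range_self i)).trans (le_max_left _ _))

end SwitchedObserver

theorem mainTheorem11 {N n p q : ℕ} (P : SwitchedObserver.SwitchedPlant N n p q)
    (T h : ℝ) (hT : 0 < T) (hh : 0 < h)
    (M : Matrix (Fin n) (Fin n) ℝ) (hM : ∀ a b, 0 ≤ M a b)
    (X : Fin N → ℝ → Matrix (Fin n) (Fin n) ℝ) (Y : Fin N → ℝ → Matrix (Fin n) (Fin q) ℝ)
    (U : Matrix (Fin n) (Fin n) ℝ) (ε α γ : ℝ) (hε : 0 < ε) (hα : 0 < α) (hγ : 0 < γ)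
    (hXdiag : ∀ i, ∀ τ ∈ Icc 0 T, (X i τ).IsDiag)
    (hXdiff : ∀ i a b, DifferentiableOn ℝ (fun τ => X i τ a b) (Icc 0 T))
    (hX0 : ∀ i, (X i 0).PosDef) (hXT : ∀ i, (X i T).PosDef)
    (hXinv : ∀ i, ∀ τ ∈ Icc 0 T, IsUnit (X i τ))
    (hUdiag : U.IsDiag) (hU : U.PosDef)
    (hA : ∀ i, ∀ τ ∈ Icc 0 T, ∀ a b,
      0 ≤ (X i τ * P.A i - Y i τ * P.C i + α • (1 : Matrix (Fin n) (Fin n) ℝ)) a b)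
    (hG : ∀ i, ∀ τ ∈ Icc 0 T, ∀ a b, 0 ≤ (X i τ * P.G i - Y i τ * P.H i) a b)
    (hE : ∀ i, ∀ τ ∈ Icc 0 T, ∀ a b, 0 ≤ (X i τ * P.E i - Y i τ * P.F i) a b)
    (hAT : ∀ i, 1 ᵥ* (X i T * P.A i - Y i T * P.C i + U) + 1 ᵥ* M ≤ 0)
    (hGT : ∀ i, 1 ᵥ* (X i T * P.G i - Y i T * P.H i - U) ≤ 0)
    (hET : ∀ i, 1 ᵥ* (X i T * P.E i - Y i T * P.F i) - γ • (1 : Fin p → ℝ) ≤ 0)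
    (hAτ : ∀ i, ∀ τ ∈ Icc 0 T,
      1 ᵥ* (SwitchedObserver.matrixDeriv T (X i) τ + X i τ * P.A i - Y i τ * P.C i + U)
        + 1 ᵥ* M ≤ 0)
    (hGτ : ∀ i, ∀ τ ∈ Icc 0 T, 1 ᵥ* (X i τ * P.G i - Y i τ * P.H i - U) ≤ 0)
    (hEτ : ∀ i, ∀ τ ∈ Icc 0 T,
      1 ᵥ* (X i τ * P.E i - Y i τ * P.F i) - γ • (1 : Fin p → ℝ) ≤ 0)
    (hJ : ∀ i j, i ≠ j →
      1 ᵥ* (X i 0 - X j T + ε • (1 : Matrix (Fin n) (Fin n) ℝ)) ≤ 0) :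
    P.SolvesObservationProblem T h γ M (fun i τ => (X i τ)⁻¹ * Y i τ) := by
  have hcont : ∀ i a, ContinuousOn (fun τ => X i τ a a) (Icc 0 T) := fun i a =>
    (hXdiff i a a).continuousOn
  have hpos : ∀ i a, ∀ τ ∈ Icc 0 T, 0 < X i τ a a := fun i a τ hτ =>
    SwitchedObserver.pos_of_continuousOn_of_ne_zero (hcont i a) (hX0 i).diag_pos
      (fun t ht => (hXdiag i t ht).apply_ne_zero (hXinv i t ht) a) hτ
  obtain ⟨c, K, hc, hK, hbounds⟩ := SwitchedObserver.exists_bounds_of_continuousOn hT.le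
    (f := fun (x : Fin N × Fin n) τ => X x.1 τ x.2 x.2) (fun x => hcont x.1 x.2)
    fun x => hpos x.1 x.2
  have h0T := left_mem_Icc.2 hT.le
  have hTT := right_mem_Icc.2 hT.le
  refine SwitchedObserver.GainCertificate.solvesObservationProblem (c := c) (C := K) (α := α)
    (ε := ε) (u := fun a => U a a) (w := fun i τ a => X i τ a a)
    (w' := fun i τ a => SwitchedObserver.matrixDeriv T (X i) τ a a)
    { T_pos := hT
      c_pos := hc
      C_nonneg := hK
      ε_pos := hε
      α_nonneg := hα.le
      u_nonneg := fun a => hU.diag_pos.le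
      hasDeriv := fun i a τ hτ => (hXdiff i a a τ hτ).hasDerivWithinAt
      flow := fun i τ hτ => SwitchedObserver.flowBound_of_columns (hXdiag i τ hτ) (hXinv i τ hτ)
        (fun a => hpos i a τ hτ) (SwitchedObserver.matrixDeriv_isDiag (hXdiag i) hτ) hUdiag hM
        (hA i τ hτ) (hG i τ hτ) (hE i τ hτ) (hAτ i τ hτ) (hGτ i τ hτ) (hEτ i τ hτ)
      flow_end := fun i => SwitchedObserver.flowBound_of_columns (D := 0) (hXdiag i T hTT)
        (hXinv i T hTT) (fun a => hpos i a T hTT) (Matrix.isDiag_zero) hUdiag hM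
        (hA i T hTT) (hG i T hTT) (hE i T hTT) (by simpa only [zero_add] using hAT i) (hGT i)
        (hET i)
      diag_ge := fun i τ hτ a => by
        have h1 := hA i τ hτ a a
        rw [SwitchedObserver.diag_mul_closedLoop (hXdiag i τ hτ) (hXinv i τ hτ)]
        simp only [Matrix.add_apply, Matrix.smul_apply, Matrix.one_apply_eq, smul_eq_mul,
          mul_one] at h1
        linarith
      weight_ge := fun i τ hτ a => (hbounds (i, a) τ hτ).1
      weight_le := fun i τ hτ a => (hbounds (i, a) τ hτ).2
      jump := fun i j hij a => by
        have h1 := hJ i j hij a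
        rw [SwitchedObserver.one_vecMul_apply] at h1
        simp only [Matrix.add_apply, Matrix.sub_apply, Finset.sum_add_distrib,
          Finset.sum_sub_distrib, (hXdiag i 0 h0T).sum_column, (hXdiag j T hTT).sum_column,
          ← Finset.mul_sum, Matrix.isDiag_one.sum_column, Pi.zero_apply, Matrix.smul_apply,
          Matrix.one_apply_eq, smul_eq_mul, mul_one] at h1
        linarith } hh.le hγ.le
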